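/- All graphs are finite and directed (loops allowed). The Cartesian product $G\,\square\,H$ and the tensor product $G\times H$ have vertex set $V(G)\times V(H)$, where tuples are flattened, so that products are associative on vertices; $((v_1,u_1),(v_2,u_2))$ is an edge of $G\,\square\,H$ iff $v_1=v_2$ and $(u_1,u_2)\in E(H)$, or $u_1=u_2$ and $(v_1,v_2)\in E(G)$; it is an edge of $G\times H$ iff $(v_1,v_2)\in E(G)$ and $(u_1,u_2)\in E(H)$. The union $G\cup H$ has vertex set $V(G)\cup V(H)$ and edge set $E(G)\cup E(H)$. A factored graph of complexity $(n,k)$ is a graph given by a formula with $k-1$ operations $\square,\times,\cup$ on explicitly given input graphs with at most $n$ vertices each; the vertices of the input graphs are named by numbers in $\{0,\dots,kn-1\}$. In the reachability problem on factored graphs one is given such a formula, with value $G$, and $s,t\in V(G)$, and has to decide whether there is a directed path from $s$ to $t$ in $G$. The problem is fixed parameter tractable if there are a constant $C$ and a function $g$ such that, for every $k$, there is a deterministic algorithm (Turing machine) that solves it on factored graphs of complexity $(n,k)$ in time $O(g(k)\,n^{C})$, for all $n$; here $C$ does not depend on $k$. **Theorem.** If reachability on factored graphs is not fixed parameter tractable,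 then there is no constant $C$ such that $\mathbf{NL}\subseteq\mathbf{DTIME}(n^{C})$. (Equivalently: if $\mathbf{NL}\subseteq\mathbf{DTIME}(n^{C})$ for some constant $C$, then reachability on factored graphs is fixed parameter tractable.) -/

import Mathlib

/-! ### Turing machines with a read-only input tape and any number of work tapes -/

namespace Machine

/-- What the input head sees: the left end-marker, a bit of the input, or the right end-marker. -/
inductive InSym where
  | leftEnd
  | bit (b : Bool)
  | rightEnd

inductive Dir where
  | left
  | stay
  | right

/-- A (in general nondeterministic) Turing machine over the input alphabet `{0,1}`, with a two-way
read-only input tape and `tapes` two-way infinite work tapes. -/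
structure TM where
  tapes : ℕ
  State : Type
  Sym : Type
  finState : Finite State
  finSym : Finite Sym
  blank : Sym
  start : State
  accept : Set State
  /-- The possible moves, given the state and the scanned symbols: new state, move of the input
  head, and for each work tape the symbol to be written and the move of the head. -/
  trans : State → InSym → (Fin tapes → Sym) → Set (State × Dir × (Fin tapes → Sym × Dir))

namespace TM

/-- At most one move is possible in every situation. -/
def Deterministic (M : TM) : Prop :=
  ∀ q a w, (M.trans q a w).Subsingleton

/-- A configuration. The input head has a position in `{0, …, n + 1}`, where `n` is the length of
the input; positions `0` and `n + 1` hold the end-markers. -/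
structure Cfg (M : TM) where
  state : M.State
  inPos : ℕ
  head : Fin M.tapes → ℤ
  tape : Fin M.tapes → ℤ → M.Sym

def inputAt (x : List Bool) (p : ℕ) : InSym :=
  if p = 0 then InSym.leftEnd
  else match x[p - 1]? with
    | some b => InSym.bit b
    | none => InSym.rightEnd

/-- The input head cannot leave the part of the tape between the two end-markers. -/
def moveIn (n : ℕ) : Dir → ℕ → ℕ
  | Dir.left, p => p - 1
  | Dir.stay, p => p
  | Dir.right, p => min (p + 1) (n + 1)

def moveWork : Dir → ℤ → ℤ
  | Dir.left, p => p - 1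
  | Dir.stay, p => p
  | Dir.right, p => p + 1

variable (M : TM)

def init : Cfg M where
  state := M.start
  inPos := 0
  head := fun _ => 0
  tape := fun _ _ => M.blank

/-- The moves available in configuration `c` on input `x`. -/
def moves (x : List Bool) (c : Cfg M) : Set (M.State × Dir × (Fin M.tapes → Sym M × Dir)) :=
  M.trans c.state (inputAt x c.inPos) (fun i => c.tape i (c.head i))

/-- The configuration after a move. -/
def apply (x : List Bool) (c : Cfg M) (m : M.State × Dir × (Fin M.tapes → Sym M × Dir)) : Cfg M where
  state := m.1
  inPos := moveIn x.length m.2.1 c.inPos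
  head := fun i => moveWork (m.2.2 i).2 (c.head i)
  tape := fun i => Function.update (c.tape i) (c.head i) (m.2.2 i).1

def Step (x : List Bool) (c d : Cfg M) : Prop :=
  ∃ m ∈ moves M x c, d = apply M x c m

def Halted (x : List Bool) (c : Cfg M) : Prop :=
  moves M x c = ∅

/-- `M` can go from `c` to `d` in exactly `t` steps. -/
inductive StepsTo (x : List Bool) : ℕ → Cfg M → Cfg M → Prop
  | refl (c : Cfg M) : StepsTo x 0 c c
  | tail {t : ℕ} {c d e : Cfg M} : StepsTo x t c d → Step M x d e → StepsTo x (t + 1) c e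

/-- `c` occurs in some computation of `M` on input `x`. -/
def Occurs (x : List Bool) (c : Cfg M) : Prop :=
  ∃ t, StepsTo M x t (init M) c

/-- Acceptance: some computation halts in an accepting state. -/
def Accepts (x : List Bool) : Prop :=
  ∃ c, Occurs M x c ∧ Halted M x c ∧ c.state ∈ M.accept

/-- (For deterministic `M`.) On input `x`, `M` halts after exactly `t` steps, and it accepts if and
only if `answer` holds. -/
def AnswersIn (x : List Bool) (t : ℕ) (answer : Prop) : Prop :=
  ∃ c, StepsTo M x t (init M) c ∧ Halted M x c ∧ (c.state ∈ M.accept ↔ answer)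

/-- On input `x`, the work heads stay within distance `s` of their starting cells in all
computations. Up to a constant factor, `s` bounds the number of visited work-tape cells. -/
def UsesSpace (x : List Bool) (s : ℝ) : Prop :=
  ∀ c, Occurs M x c → ∀ i, (((c.head i).natAbs : ℕ) : ℝ) ≤ s

end TM

/-- Languages decided by deterministic machines in time `O(T(n))`, where `n` is the input length. -/
def DTIME (T : ℕ → ℝ) : Set (Language Bool) :=
  {L | ∃ M : TM, M.Deterministic ∧ ∃ c : ℕ, ∀ x : List Bool,
    ∃ t : ℕ, (t : ℝ) ≤ c * T x.length + c ∧ M.AnswersIn x t (x ∈ L)}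

/-- Languages accepted by nondeterministic machines in space `O(S(n))`, on all computations. -/
def NSPACE (S : ℕ → ℝ) : Set (Language Bool) :=
  {L | ∃ M : TM, (∀ x : List Bool, M.Accepts x ↔ x ∈ L) ∧ ∃ c : ℕ, ∀ x : List Bool,
    M.UsesSpace x (c * S x.length + c)}

/-- Nondeterministic logarithmic space. -/
noncomputable def NL : Set (Language Bool) :=
  NSPACE (fun n => Real.logb 2 n)

end Machine

/-! ### Factored graphs -/

namespace Factored

/-- A directed graph whose vertices are finite sequences of labels. -/
structure SeqGraph where
  V : Set (List ℕ)
  Adj : List ℕ → List ℕ → Prop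

namespace SeqGraph

/-- Cartesian product; pairs of vertices are flattened to one sequence. -/
def cart (G H : SeqGraph) : SeqGraph where
  V := {w | ∃ v ∈ G.V, ∃ u ∈ H.V, w = v ++ u}
  Adj a b := ∃ v₁ ∈ G.V, ∃ u₁ ∈ H.V, ∃ v₂ ∈ G.V, ∃ u₂ ∈ H.V, a = v₁ ++ u₁ ∧ b = v₂ ++ u₂ ∧
    ((v₁ = v₂ ∧ H.Adj u₁ u₂) ∨ (u₁ = u₂ ∧ G.Adj v₁ v₂))

/-- Tensor product; pairs of vertices are flattened to one sequence. -/
def tensor (G H : SeqGraph) : SeqGraph where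
  V := {w | ∃ v ∈ G.V, ∃ u ∈ H.V, w = v ++ u}
  Adj a b := ∃ v₁ ∈ G.V, ∃ u₁ ∈ H.V, ∃ v₂ ∈ G.V, ∃ u₂ ∈ H.V, a = v₁ ++ u₁ ∧ b = v₂ ++ u₂ ∧
    G.Adj v₁ v₂ ∧ H.Adj u₁ u₂

/-- Union of the vertex sets and of the edge sets. -/
def union (G H : SeqGraph) : SeqGraph where
  V := G.V ∪ H.V
  Adj a b := G.Adj a b ∨ H.Adj a b

/-- `t` can be reached from `s` along a directed path (of length zero if `s = t`). -/
def Reaches (G : SeqGraph) (s t : List ℕ) : Prop :=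
  Relation.ReflTransGen G.Adj s t

end SeqGraph

/-- An explicitly given finite directed graph (loops allowed): the list of the vertices, which are
labels in `ℕ`, and the list of the edges, both without repetition. -/
structure InputGraph where
  verts : List ℕ
  edges : List (ℕ × ℕ)
  verts_nodup : verts.Nodup
  edges_nodup : edges.Nodup
  edges_mem : ∀ e ∈ edges, e.1 ∈ verts ∧ e.2 ∈ verts

def InputGraph.toSeqGraph (G : InputGraph) : SeqGraph where
  V := {w | ∃ v ∈ G.verts, w = [v]}
  Adj a b := ∃ e ∈ G.edges, a = [e.1] ∧ b = [e.2]

/-- Factored graph formulas. -/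
inductive Formula where
  | input (G : InputGraph)
  | cart (f g : Formula)
  | tensor (f g : Formula)
  | union (f g : Formula)

namespace Formula

/-- The factored graph given by a formula. -/
def graph : Formula → SeqGraph
  | input G => G.toSeqGraph
  | cart f g => f.graph.cart g.graph
  | tensor f g => f.graph.tensor g.graph
  | union f g => f.graph.union g.graph

/-- The number of operations in a formula. -/
def numOps : Formula → ℕ
  | input _ => 0
  | cart f g => f.numOps + g.numOps + 1
  | tensor f g => f.numOps + g.numOps + 1
  | union f g => f.numOps + g.numOps + 1

/-- The input graphs of a formula, from left to right. -/
def inputs : Formula → List InputGraph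
  | input G => [G]
  | cart f g => f.inputs ++ g.inputs
  | tensor f g => f.inputs ++ g.inputs
  | union f g => f.inputs ++ g.inputs

/-- Complexity `(n, k)`: `k - 1` operations on input graphs with at most `n` vertices. -/
def HasComplexity (f : Formula) (n k : ℕ) : Prop :=
  f.numOps + 1 = k ∧ ∀ G ∈ f.inputs, G.verts.length ≤ n

/-- All vertices of the input graphs are labelled by numbers smaller than `N`. -/
def LabelsBelow (f : Formula) (N : ℕ) : Prop :=
  ∀ G ∈ f.inputs, ∀ v ∈ G.verts, v < N

end Formula

/-! ### Instances of the reachability problem as bit strings -/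

/-- A list preceded by its length. -/
def withLength (l : List ℕ) : List ℕ :=
  l.length :: l

def InputGraph.tokens (G : InputGraph) : List ℕ :=
  withLength G.verts ++ G.edges.length :: G.edges.flatMap (fun e => [e.1, e.2])

/-- A formula in prefix notation, as a list of numbers. -/
def Formula.tokens : Formula → List ℕ
  | input G => 0 :: G.tokens
  | cart f g => 1 :: (f.tokens ++ g.tokens)
  | tensor f g => 2 :: (f.tokens ++ g.tokens)
  | union f g => 3 :: (f.tokens ++ g.tokens)

/-- Lists of numbers as bit strings: a number `a` is written as `a` ones followed by a zero. -/
def encodeNats (l : List ℕ) : List Bool :=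
  l.flatMap (fun a => List.replicate a true ++ [false])

/-- An instance of reachability on factored graphs. -/
structure Instance where
  formula : Formula
  source : List ℕ
  target : List ℕ
  source_mem : source ∈ formula.graph.V
  target_mem : target ∈ formula.graph.V

namespace Instance

def Yes (I : Instance) : Prop :=
  I.formula.graph.Reaches I.source I.target

/-- The input string of an instance. Since the labels used below are less than `k * n`, its length is
polynomial in `n` and `k`, so that writing labels in unary does not affect tractability. -/
def encode (I : Instance) : List Bool :=
  encodeNats (I.formula.tokens ++ withLength I.source ++ withLength I.target)

/-- The formula has complexity `(n, k)`. The at most `k * n` vertices of its `k` input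
graphs are named by numbers below `k * n`; this is no loss of generality, and it keeps the length of
the names from entering the size of the input. -/
def HasComplexity (I : Instance) (n k : ℕ) : Prop :=
  I.formula.HasComplexity n k ∧ I.formula.LabelsBelow (k * n)

end Instance

/-- Reachability on factored graphs is fixed parameter tractable: there are an absolute constant `C`
and a function `g` such that, for each fixed `k`, an algorithm solves the problem on factored graphs
of complexity `(n, k)` in time at most `g k * n ^ C`, for all `n`. -/
def ReachabilityFPT : Prop :=
  ∃ (C : ℕ) (g : ℕ → ℕ), ∀ k : ℕ, ∃ M : Machine.TM, M.Deterministic ∧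
    ∀ (I : Instance) (n : ℕ), I.HasComplexity n k →
      ∃ t : ℕ, t ≤ g k * n ^ C ∧ M.AnswersIn I.encode t I.Yes

end Factored

/-! Fix `k`. A vertex of a factored graph of complexity `(n, k)` is a sequence of at most `k`
labels, and each label is written in unary in the input. Hence a vertex fits into `k` counters
bounded by the input length, that is, into logarithmic space. An edge can be guessed and verified in
one pass over the formula: at a product the sequence is cut at a guessed place, at a union a side is
guessed, and at an input graph a member of its list is guessed. So for each fixed `k`, reachability
is the restriction to valid instances of some language in NL; what happens on other strings is
irrelevant.

If NL is contained in `DTIME (n ^ C)`, each of these languages is decided in time `c_k * |x| ^ C +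
c_k` with one and the same `C`. An instance of complexity `(n, k)` has length at most `22 k² n³`
(`Instance.length_encode_le`), so the time is at most `g k * n ^ (3⌈C⌉₊)`: only the factor depends
on `k`.

Most of the work is membership in NL for a concrete machine model. The algorithm is written as a
`Prog`, a regular expression over elementary actions whose meaning `Prog.den` is a relation on
memories. `Prog.exists_implements` compiles it to a nondeterministic counter machine, and
`CounterMachine.toTM` keeps the counters in binary on work tapes (`CounterMachine.mem_NL`). Space
has to be bounded on all computations, including those that get stuck or never end. Programs have
this property automatically: they have no increment, only `load`, which fills an empty counter with
the length of a run of ones in the input. `Prog.exists_den_reachability` states that the algorithm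
is correct. -/

namespace Machine

open Relation (ReflTransGen)

/-! ### Counter machines -/

/-- The instructions of counter machines with a two-way input head. -/
inductive Op where
  | move (d : Dir)
  | inc (i : ℕ)
  | dec (i : ℕ)
  | zero (i : ℕ)

/-- The position of the input head and the values of the counters. -/
structure Mem where
  pos : ℕ
  cnt : ℕ → ℕ

/-- The effect of an instruction on inputs of length `n`; `dec` is possible only on positive
counters, and `zero` is a test. -/
inductive Op.Eff (n : ℕ) : Op → Mem → Mem → Prop
  | move (d : Dir) (p : ℕ) (c : ℕ → ℕ) : Eff n (.move d) ⟨p, c⟩ ⟨TM.moveIn n d p, c⟩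
  | inc (i p : ℕ) (c : ℕ → ℕ) : Eff n (.inc i) ⟨p, c⟩ ⟨p, Function.update c i (c i + 1)⟩
  | dec (i p v : ℕ) (c : ℕ → ℕ) (h : c i = v + 1) :
      Eff n (.dec i) ⟨p, c⟩ ⟨p, Function.update c i v⟩
  | zero (i p : ℕ) (c : ℕ → ℕ) (h : c i = 0) : Eff n (.zero i) ⟨p, c⟩ ⟨p, c⟩

/-- The counter used by an instruction. -/
def Op.index : Op → ℕ
  | .move _ => 0
  | .inc i => i
  | .dec i => i
  | .zero i => i

/-- Nondeterministic counter machines with a two-way input head. -/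
structure CounterMachine where
  State : Type
  finState : Finite State
  start : State
  final : State
  rules : State → InSym → Op → State → Prop
  width : ℕ
  index_le : ∀ q a op q', rules q a op q' → op.index ≤ width

namespace CounterMachine

variable (A : CounterMachine)

inductive Step (x : List Bool) : A.State × Mem → A.State × Mem → Prop
  | mk {q q' : A.State} {σ τ : Mem} {op : Op} (hr : A.rules q (TM.inputAt x σ.pos) op q')
      (he : op.Eff x.length σ τ) : Step x (q, σ) (q', τ)

def Reach (x : List Bool) : A.State × Mem → A.State × Mem → Prop :=
  ReflTransGen (A.Step x)

end CounterMachine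

def Mem.init : Mem := ⟨0, fun _ => 0⟩

/-- All counters are at most `n + 1`. -/
def Mem.Bdd (n : ℕ) (σ : Mem) : Prop := ∀ i, σ.cnt i ≤ n + 1

/-! ### Binary counters on tapes -/

/-- A tape with the given symbols in the cells `0, 1, …` and blanks elsewhere. -/
def digitTape (d : List Bool) : ℤ → Option Bool :=
  fun j => if 0 ≤ j then d[j.toNat]? else none

/-- The value of a binary number, least significant bit first. -/
def bval : List Bool → ℕ
  | [] => 0
  | b :: l => b.toNat + 2 * bval l

def incBits : List Bool → List Bool
  | [] => [true]
  | false :: r => true :: r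
  | true :: r => false :: incBits r

def decBits : List Bool → List Bool
  | [] => []
  | true :: r => false :: r
  | false :: r => true :: decBits r

theorem bval_incBits (d : List Bool) : bval (incBits d) = bval d + 1 := by
  induction d with
  | nil => rfl
  | cons b r ih => cases b <;> simp [incBits, bval, ih] <;> ring

theorem bval_decBits (d : List Bool) (h : 0 < bval d) : bval (decBits d) + 1 = bval d := by
  induction d with
  | nil => simp [bval] at h
  | cons b r ih => cases b <;> simp [decBits, bval] at h ih ⊢ <;> omega

theorem length_decBits (d : List Bool) : (decBits d).length = d.length := by
  induction d with
  | nil => rfl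
  | cons b r ih => cases b <;> simp [decBits, ih]

/-- A digit is added only when the carry runs off the end, so that the new value is a power of two
with no leading zeros. Leading zeros do occur otherwise, because decrementing keeps the length;
hence the length is not bounded by the current value and the alternative is needed. -/
theorem two_pow_length_incBits (d : List Bool) :
    (incBits d).length = d.length ∨ 2 ^ (incBits d).length ≤ 2 * (bval d + 1) := by
  induction d with
  | nil => simp [incBits, bval]
  | cons b r ih =>
    cases b
    · simp [incBits]
    · rcases ih with ih | ih
      · simp [incBits, ih]
      · right
        simp only [incBits, bval, List.length_cons, pow_succ, Bool.toNat_true]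
        omega

theorem digitTape_append_cons (l r : List Bool) (b : Bool) :
    digitTape (l ++ b :: r) l.length = some b := by
  simp [digitTape]

theorem digitTape_length (l : List Bool) : digitTape l l.length = none := by
  simp [digitTape]

theorem digitTape_neg (l : List Bool) : digitTape l (-1) = none := by
  simp [digitTape]

theorem update_digitTape_cons (l r : List Bool) (b b' : Bool) :
    Function.update (digitTape (l ++ b :: r)) l.length (some b') = digitTape (l ++ b' :: r) := by
  funext j
  by_cases hj : j = l.length
  · subst hj; simp [digitTape]
  · rw [Function.update_of_ne hj]
    unfold digitTape
    split_ifs with h0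
    · rw [List.getElem?_append, List.getElem?_append]
      split_ifs with h1
      · rfl
      · obtain ⟨t, ht⟩ : ∃ t, j.toNat - l.length = t + 1 := ⟨j.toNat - l.length - 1, by omega⟩
        simp [ht]
    · rfl

theorem update_digitTape_length (l : List Bool) (b : Bool) :
    Function.update (digitTape l) l.length (some b) = digitTape (l ++ [b]) := by
  funext j
  by_cases hj : j = l.length
  · subst hj; simp [digitTape]
  · rw [Function.update_of_ne hj]
    unfold digitTape
    split_ifs with h0
    · rw [List.getElem?_append]
      split_ifs with h1
      · rfl
      · rw [List.getElem?_eq_none (by omega), List.getElem?_eq_none (by simp; omega)]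
    · rfl

/-! ### From counter machines to Turing machines -/

namespace CounterMachine

/-- The phases of an operation on a binary counter. -/
inductive Phase where
  | carry
  | borrow
  | test
  | back

theorem finite_phase : Finite Phase :=
  Finite.of_injective (β := Fin 4)
    (fun | .carry => 0 | .borrow => 1 | .test => 2 | .back => 3)
    (by intro a b; cases a <;> cases b <;> simp)

variable (A : CounterMachine)

/-- The states of the simulating machine: a counter machine state, together with the phase and the
tape of the operation that is under way, if any. -/
abbrev TState : Type := A.State × Option (Phase × Fin (A.width + 1))

/-- The beginning of an operation that leads to the state `q`. -/
def issue (q : A.State) : Op → A.TState × Dir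
  | .move d => ((q, none), d)
  | .inc i => ((q, some (.carry, Fin.ofNat _ i)), .stay)
  | .dec i => ((q, some (.borrow, Fin.ofNat _ i)), .stay)
  | .zero i => ((q, some (.test, Fin.ofNat _ i)), .stay)

/-- One step of an operation on the tape `i`. -/
def work (q : A.State) (i : Fin (A.width + 1)) :
    Phase → Option Bool → Option (A.TState × Option Bool × Dir)
  | .carry, some true => some ((q, some (.carry, i)), some false, .right)
  | .carry, some false => some ((q, some (.back, i)), some true, .stay)
  | .carry, none => some ((q, some (.back, i)), some true, .stay)
  | .borrow, some false => some ((q, some (.borrow, i)), some true, .right)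
  | .borrow, some true => some ((q, some (.back, i)), some false, .stay)
  | .borrow, none => none
  | .test, some false => some ((q, some (.test, i)), some false, .right)
  | .test, some true => none
  | .test, none => some ((q, some (.back, i)), none, .left)
  | .back, some b => some ((q, some (.back, i)), some b, .left)
  | .back, none => some ((q, none), none, .right)

/-- The Turing machine that keeps each counter in binary on a tape of its own. -/
abbrev toTM : TM where
  tapes := A.width + 1
  State := A.TState
  Sym := Option Bool
  finState := by
    have := A.finState
    have := finite_phase
    infer_instance
  finSym := inferInstance
  blank := none
  start := (A.start, none)
  accept := {(A.final, none)}
  trans s a w :=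
    match s with
    | (q, none) => {μ | q ≠ A.final ∧ ∃ op q', A.rules q a op q' ∧
        μ = ((A.issue q' op).1, (A.issue q' op).2, fun j => (w j, .stay))}
    | (q, some (ph, i)) => {μ | ∃ r, A.work q i ph (w i) = some r ∧
        μ = (r.1, .stay, Function.update (fun j => (w j, Dir.stay)) i r.2)}

/-- The configuration with the head of tape `i` at `h`, all other heads at `0`, the digits `e` on
tape `i`, and the digits `D j` on the other tapes `j`. -/
def conf (s : A.TState) (p : ℕ) (i : Fin (A.width + 1)) (h : ℤ) (e : List Bool)
    (D : Fin (A.width + 1) → List Bool) : TM.Cfg A.toTM where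
  state := s
  inPos := p
  head := Function.update (fun _ => 0) i h
  tape := Function.update (fun j => digitTape (D j)) i (digitTape e)

variable {A}

/-- Between operations no tape is special, so the distinguished tape may be switched to the one that
the next operation uses. -/
theorem conf_main (s : A.TState) (p : ℕ) (i j : Fin (A.width + 1))
    (D : Fin (A.width + 1) → List Bool) :
    A.conf s p i 0 (D i) D = A.conf s p j 0 (D j) D := by
  unfold conf
  congr 1
  · rw [Function.update_eq_self_iff.2 rfl, Function.update_eq_self_iff.2 rfl]
  · rw [Function.update_eq_self_iff.2 rfl, Function.update_eq_self_iff.2 rfl]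

/-- Since `e` overrides `D i`, the entry `D i` is free to record what tape `i` will hold when the
operation under way is finished. -/
theorem conf_update (s : A.TState) (p : ℕ) (i : Fin (A.width + 1)) (h : ℤ) (e e' : List Bool)
    (D : Fin (A.width + 1) → List Bool) :
    A.conf s p i h e (Function.update D i e') = A.conf s p i h e D := by
  unfold conf
  congr 1
  funext j
  by_cases hj : j = i
  · subst hj; simp
  · simp [hj]

theorem step_work_iff (x : List Bool) (q : A.State) (ph : Phase) (p : ℕ) (i : Fin (A.width + 1))
    (h : ℤ) (e : List Bool) (D : Fin (A.width + 1) → List Bool) (d : TM.Cfg A.toTM) :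
    TM.Step A.toTM x (A.conf (q, some (ph, i)) p i h e D) d ↔
      ∃ r, A.work q i ph (digitTape e h) = some r ∧
        d = ⟨r.1, p, Function.update (fun _ => 0) i (TM.moveWork r.2.2 h),
          Function.update (fun j => digitTape (D j)) i
            (Function.update (digitTape e) h r.2.1)⟩ := by
  have hap : ∀ r : A.TState × Option Bool × Dir,
      TM.apply A.toTM x (A.conf (q, some (ph, i)) p i h e D)
        (r.1, .stay, Function.update (fun j => ((A.conf (q, some (ph, i)) p i h e D).tape j
          ((A.conf (q, some (ph, i)) p i h e D).head j), Dir.stay)) i r.2) =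
      ⟨r.1, p, Function.update (fun _ => 0) i (TM.moveWork r.2.2 h),
          Function.update (fun j => digitTape (D j)) i
            (Function.update (digitTape e) h r.2.1)⟩ := by
    intro r
    unfold TM.apply
    congr 1
    · funext j
      by_cases hj : j = i
      · subst hj; simp [conf]
      · simp [conf, hj, TM.moveWork]
    · funext j
      by_cases hj : j = i
      · subst hj; simp [conf]
      · simp [conf, hj]
  have hsc : (A.conf (q, some (ph, i)) p i h e D).tape i
      ((A.conf (q, some (ph, i)) p i h e D).head i) = digitTape e h := by simp [conf]
  constructor
  · rintro ⟨μ, ⟨r, hr, rfl⟩, rfl⟩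
    exact ⟨r, hsc ▸ hr, hap r⟩
  · rintro ⟨r, hr, rfl⟩
    exact ⟨_, ⟨r, by rw [← hr, ← hsc], rfl⟩, (hap r).symm⟩

theorem step_main_iff (x : List Bool) (q : A.State) (p : ℕ) (i : Fin (A.width + 1))
    (D : Fin (A.width + 1) → List Bool) (d : TM.Cfg A.toTM) :
    TM.Step A.toTM x (A.conf (q, none) p i 0 (D i) D) d ↔
      q ≠ A.final ∧ ∃ op q', A.rules q (TM.inputAt x p) op q' ∧
        d = A.conf (A.issue q' op).1 (TM.moveIn x.length (A.issue q' op).2 p) i 0 (D i) D := by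
  have hap : ∀ (s : A.TState) (dir : Dir),
      TM.apply A.toTM x (A.conf (q, none) p i 0 (D i) D)
        (s, dir, fun j => ((A.conf (q, none) p i 0 (D i) D).tape j
          ((A.conf (q, none) p i 0 (D i) D).head j), .stay)) =
      A.conf s (TM.moveIn x.length dir p) i 0 (D i) D := by
    intro s dir
    unfold TM.apply
    rw [conf]
    congr 1
    funext j
    simp
  constructor
  · rintro ⟨μ, ⟨hq, op, q', hr, rfl⟩, rfl⟩
    exact ⟨hq, op, q', hr, hap _ _⟩
  · rintro ⟨hq, op, q', hr, rfl⟩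
    exact ⟨_, ⟨hq, op, q', hr, rfl⟩, (hap _ _).symm⟩

end CounterMachine
end Machine

/-! ### Soundness of the simulation: an invariant of all occurring configurations -/

namespace Machine

open Relation (ReflTransGen)

namespace CounterMachine

variable {A : CounterMachine}

/-- The digits on the tapes represent the counters. -/
def Rep (D : Fin (A.width + 1) → List Bool) (c : ℕ → ℕ) : Prop := ∀ j, bval (D j) = c j

/-- The binary numbers on the tapes are of logarithmic length. -/
def Short (n : ℕ) (D : Fin (A.width + 1) → List Bool) : Prop :=
  ∀ j, 2 ^ (D j).length ≤ 2 * (n + 1)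

/-- What holds for all configurations that occur in computations of `A.toTM`. -/
inductive Inv (x : List Bool) : TM.Cfg A.toTM → Prop
  | main {q p c D} (i) (hr : A.Reach x (A.start, Mem.init) (q, ⟨p, c⟩)) (hD : Rep D c)
      (hs : Short x.length D) : Inv x (A.conf (q, none) p i 0 (D i) D)
  | back {q p c D i} {h : ℤ} (hr : A.Reach x (A.start, Mem.init) (q, ⟨p, c⟩)) (hD : Rep D c)
      (hs : Short x.length D) (h1 : -1 ≤ h) (h2 : h < (D i).length) :
      Inv x (A.conf (q, some (.back, i)) p i h (D i) D)
  -- In this and the following phases `l` is already processed and `r` is still to be scanned; `D i`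
  -- is the outcome, and `q`, `c` belong to the state after the operation.
  | carry {q p c D i l r} (hr : A.Reach x (A.start, Mem.init) (q, ⟨p, c⟩)) (hD : Rep D c)
      (hs : Short x.length D) (he : l ++ incBits r = D i) :
      Inv x (A.conf (q, some (.carry, i)) p i l.length (l ++ r) D)
  -- Decrementing zero and testing a positive counter start but get stuck. The counter machine has
  -- no corresponding step, so reachability is claimed only if the remaining digits allow success.
  -- For `borrow` this also covers `Rep`, as `decBits` of zero is meaningless.
  | borrow {q p c D i l r}
      (hr : 0 < bval r → A.Reach x (A.start, Mem.init) (q, ⟨p, c⟩) ∧ Rep D c)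
      (hs : Short x.length D) (he : l ++ decBits r = D i) :
      Inv x (A.conf (q, some (.borrow, i)) p i l.length (l ++ r) D)
  | test {q p c D i l r}
      (hr : bval r = 0 → A.Reach x (A.start, Mem.init) (q, ⟨p, c⟩)) (hD : Rep D c)
      (hs : Short x.length D) (he : l ++ r = D i) :
      Inv x (A.conf (q, some (.test, i)) p i l.length (l ++ r) D)

theorem conf_eq {s : A.TState} {p : ℕ} {i : Fin (A.width + 1)} {h h' : ℤ} {f : ℤ → Option Bool}
    {e : List Bool} {D : Fin (A.width + 1) → List Bool} (hh : h = h') (hf : f = digitTape e) :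
    (⟨s, p, Function.update (fun _ => 0) i h, Function.update (fun j => digitTape (D j)) i f⟩ :
      TM.Cfg A.toTM) = A.conf s p i h' e D := by
  subst hh hf; rfl

theorem update_digitTape_self (e : List Bool) (h : ℤ) :
    Function.update (digitTape e) h (digitTape e h) = digitTape e :=
  Function.update_eq_self _ _

theorem digitTape_eq_none {e : List Bool} {h : ℤ} (h1 : -1 ≤ h) (h2 : h < e.length)
    (hn : digitTape e h = none) : h = -1 := by
  by_contra hne
  have h0 : 0 ≤ h := by omega
  rw [digitTape, if_pos h0, List.getElem?_eq_none_iff] at hn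
  omega

theorem digitTape_eq_some {e : List Bool} {h : ℤ} {b : Bool} (hb : digitTape e h = some b) :
    0 ≤ h := by
  by_contra hne
  simp [digitTape, hne] at hb

theorem Rep.update {D : Fin (A.width + 1) → List Bool} {c : ℕ → ℕ} (hD : Rep D c)
    (i : Fin (A.width + 1)) {e : List Bool} {v : ℕ} (he : bval e = v) :
    Rep (Function.update D i e) (Function.update c i v) := by
  intro j
  by_cases hj : j = i
  · subst hj; simpa using he
  · rw [Function.update_of_ne hj, Function.update_of_ne (by simpa [Fin.ext_iff] using hj)]
    exact hD j

theorem Short.update {n : ℕ} {D : Fin (A.width + 1) → List Bool} (hs : Short n D)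
    (i : Fin (A.width + 1)) {e : List Bool} (he : 2 ^ e.length ≤ 2 * (n + 1)) :
    Short n (Function.update D i e) := by
  intro j
  by_cases hj : j = i
  · subst hj; simpa using he
  · rw [Function.update_of_ne hj]
    exact hs j

/-- Each operation is credited to the counter machine when it is issued; the later phases only move
the scanned digits from `r` to `l`. The bound on the counters is needed only for the tape length
after an increment. -/
theorem Inv.step {x : List Bool}
    (hB : ∀ q τ, A.Reach x (A.start, Mem.init) (q, τ) → τ.Bdd x.length)
    {c d : TM.Cfg A.toTM} (hc : Inv x c) (hcd : TM.Step A.toTM x c d) : Inv x d := by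
  cases hc with
  | @main q p c D i hr hD hs =>
    rw [step_main_iff] at hcd
    obtain ⟨-, op, q', hop, rfl⟩ := hcd
    have hidx := A.index_le _ _ _ _ hop
    have next : ∀ τ, op.Eff x.length ⟨p, c⟩ τ → A.Reach x (A.start, Mem.init) (q', τ) :=
      fun τ hτ => hr.tail (.mk hop hτ)
    cases op with
    | move dir => exact .main i (next _ (.move _ _ _)) hD hs
    | inc j =>
      obtain ⟨j, rfl⟩ : ∃ j' : Fin (A.width + 1), (j' : ℕ) = j :=
        ⟨⟨j, Nat.lt_succ_of_le hidx⟩, rfl⟩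
      have hn := next _ (.inc j p c)
      have hv : bval (incBits (D j)) = c j + 1 := by rw [bval_incBits, hD]
      have hlen : 2 ^ (incBits (D j)).length ≤ 2 * (x.length + 1) := by
        -- If the number gets longer, `2 ^ length` is at most twice the new value, which is at most
        -- `n + 1` because the counter machine reaches it.
        rcases two_pow_length_incBits (D j) with h | h
        · rw [h]; exact hs j
        · refine h.trans ?_
          have := hB _ _ hn j
          simp only [Function.update_self] at this
          rw [← bval_incBits, hv]
          omega
      rw [conf_main _ _ i j, ← conf_update _ _ _ _ _ (incBits (D j))]
      simp only [issue, Fin.ofNat_eq_cast, Fin.cast_val_eq_self]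
      exact .carry (l := []) hn (hD.update j hv) (hs.update j hlen) (by simp)
    | dec j =>
      obtain ⟨j, rfl⟩ : ∃ j' : Fin (A.width + 1), (j' : ℕ) = j :=
        ⟨⟨j, Nat.lt_succ_of_le hidx⟩, rfl⟩
      rw [conf_main _ _ i j, ← conf_update _ _ _ _ _ (decBits (D j))]
      simp only [issue, Fin.ofNat_eq_cast, Fin.cast_val_eq_self]
      -- The truncated subtraction is harmless, since `c` matters only if the counter is positive.
      refine .borrow (l := []) (c := Function.update c j (c j - 1)) (fun h0 => ?_)
        (hs.update j (by rw [length_decBits]; exact hs j)) (by simp)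
      have h1 := bval_decBits _ h0
      have h2 := hD j
      exact ⟨next _ (.dec _ _ _ _ (by omega)), hD.update j (by omega)⟩
    | zero j =>
      obtain ⟨j, rfl⟩ : ∃ j' : Fin (A.width + 1), (j' : ℕ) = j :=
        ⟨⟨j, Nat.lt_succ_of_le hidx⟩, rfl⟩
      rw [conf_main _ _ i j]
      simp only [issue, Fin.ofNat_eq_cast, Fin.cast_val_eq_self]
      exact .test (l := []) (fun h0 => next _ (.zero _ _ _ (by rw [← hD, h0]))) hD hs (by simp)
  | @back q p c D i h hr hD hs h1 h2 =>
    rw [step_work_iff] at hcd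
    obtain ⟨r, hr', rfl⟩ := hcd
    rcases hb : digitTape (D i) h with _ | b
    · obtain rfl := digitTape_eq_none h1 h2 hb
      rw [hb] at hr'
      obtain rfl := Option.some.inj hr'
      rw [conf_eq (h' := 0) (e := D i) (by simp [TM.moveWork])
        (by rw [← hb, update_digitTape_self])]
      exact .main i hr hD hs
    · have h0 := digitTape_eq_some hb
      rw [hb] at hr'
      obtain rfl := Option.some.inj hr'
      rw [conf_eq (h' := h - 1) (e := D i) (by simp [TM.moveWork])
        (by rw [← hb, update_digitTape_self])]
      exact .back hr hD hs (by omega) (by omega)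
  | @carry q p c D i l r hr hD hs he =>
    rw [step_work_iff] at hcd
    obtain ⟨m, hm, rfl⟩ := hcd
    rcases r with _ | ⟨_ | _, r⟩
    · rw [List.append_nil, digitTape_length] at hm
      obtain rfl := Option.some.inj hm
      rw [conf_eq (h' := l.length) (e := D i) (by simp [TM.moveWork])
        (by rw [← he, List.append_nil, update_digitTape_length]; rfl)]
      exact .back hr hD hs (by omega) (by rw [← he]; simp [incBits])
    · rw [digitTape_append_cons] at hm
      obtain rfl := Option.some.inj hm
      rw [conf_eq (h' := l.length) (e := D i) (by simp [TM.moveWork])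
        (by rw [← he, update_digitTape_cons]; rfl)]
      exact .back hr hD hs (by omega) (by rw [← he]; simp [incBits])
    · rw [digitTape_append_cons] at hm
      obtain rfl := Option.some.inj hm
      rw [conf_eq (h' := (l ++ [false]).length) (e := (l ++ [false]) ++ r) (by simp [TM.moveWork])
        (by rw [update_digitTape_cons]; simp)]
      exact .carry hr hD hs (by rw [← he]; simp [incBits])
  | @borrow q p c D i l r hr hs he =>
    rw [step_work_iff] at hcd
    obtain ⟨m, hm, rfl⟩ := hcd
    rcases r with _ | ⟨_ | _, r⟩
    -- The borrow has run past the last digit: the counter was zero, and there is no move.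
    · rw [List.append_nil, digitTape_length] at hm
      simp [work] at hm
    · rw [digitTape_append_cons] at hm
      obtain rfl := Option.some.inj hm
      rw [conf_eq (h' := (l ++ [true]).length) (e := (l ++ [true]) ++ r) (by simp [TM.moveWork])
        (by rw [update_digitTape_cons]; simp)]
      exact .borrow (fun h => hr (by simpa [bval] using h)) hs (by rw [← he]; simp [decBits])
    · rw [digitTape_append_cons] at hm
      obtain rfl := Option.some.inj hm
      rw [conf_eq (h' := l.length) (e := D i) (by simp [TM.moveWork])
        (by rw [← he, update_digitTape_cons]; rfl)]
      obtain ⟨hr, hD⟩ := hr (by simp [bval])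
      exact .back hr hD hs (by omega) (by rw [← he]; simp [decBits])
  | @test q p c D i l r hr hD hs he =>
    rw [step_work_iff] at hcd
    obtain ⟨m, hm, rfl⟩ := hcd
    rcases r with _ | ⟨_ | _, r⟩
    · have he' : l = D i := by simpa using he
      rw [List.append_nil, digitTape_length] at hm
      obtain rfl := Option.some.inj hm
      rw [conf_eq (h' := (l.length : ℤ) - 1) (e := D i) (by simp [TM.moveWork])
        (by rw [List.append_nil, ← he', ← digitTape_length l, update_digitTape_self])]
      exact .back (hr rfl) hD hs (by omega) (by rw [← he']; omega)
    · rw [digitTape_append_cons] at hm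
      obtain rfl := Option.some.inj hm
      rw [conf_eq (h' := (l ++ [false]).length) (e := (l ++ [false]) ++ r) (by simp [TM.moveWork])
        (by rw [update_digitTape_cons]; simp)]
      exact .test (fun h => hr (by simpa [bval] using h)) hD hs (by rw [← he]; simp)
    · rw [digitTape_append_cons] at hm
      simp [work] at hm

theorem init_eq (i : Fin (A.width + 1)) :
    TM.init A.toTM = A.conf (A.start, none) 0 i 0 [] (fun _ => []) := by
  unfold TM.init conf
  congr 1
  · simp
  · funext j k
    have : digitTape [] = fun _ => none := by funext k; simp [digitTape]
    by_cases hj : j = i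
    · subst hj; simp [this]
    · simp [hj, this]

theorem _root_.Machine.TM.occurs_iff (M : TM) (x : List Bool) (c : TM.Cfg M) :
    TM.Occurs M x c ↔ ReflTransGen (TM.Step M x) (TM.init M) c := by
  constructor
  · rintro ⟨t, ht⟩
    generalize TM.init M = c₀ at ht ⊢
    induction ht with
    | refl c => exact .refl
    | tail _ h ih => exact ih.tail h
  · intro h
    induction h with
    | refl => exact ⟨0, .refl _⟩
    | tail _ h ih =>
      obtain ⟨t, ht⟩ := ih
      exact ⟨t + 1, ht.tail h⟩

theorem Inv.of_occurs {x : List Bool}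
    (hB : ∀ q τ, A.Reach x (A.start, Mem.init) (q, τ) → τ.Bdd x.length)
    {c : TM.Cfg A.toTM} (hc : TM.Occurs A.toTM x c) : Inv x c := by
  rw [TM.occurs_iff] at hc
  induction hc with
  | refl =>
    rw [init_eq 0]
    exact .main (D := fun _ => []) 0 .refl (fun _ => rfl) (fun _ => by simp; omega)
  | tail _ h ih => exact ih.step hB h

/-! ### Simulation of the counter machine -/

/-- The head crosses `k` digits to the blank in cell `-1`, which marks the start of the number, and
then returns to cell `0`. -/
theorem steps_back (x : List Bool) (q : A.State) (p : ℕ) (i : Fin (A.width + 1))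
    (D : Fin (A.width + 1) → List Bool) (k : ℕ) (hk : k ≤ (D i).length) :
    ReflTransGen (TM.Step A.toTM x) (A.conf (q, some (.back, i)) p i ((k : ℤ) - 1) (D i) D)
      (A.conf (q, none) p i 0 (D i) D) := by
  induction k with
  | zero =>
    refine .single ((step_work_iff ..).2 ⟨((q, none), none, .right), ?_, ?_⟩)
    · simp [digitTape_neg, work]
    · refine (conf_eq (by simp [TM.moveWork]) ?_).symm
      have := digitTape_neg (D i)
      simp [← this]
  | succ k ih =>
    refine .head ((step_work_iff ..).2 ⟨((q, some (.back, i)), some (D i)[k], .left), ?_, ?_⟩)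
      (ih (by omega))
    · simp [digitTape, List.getElem?_eq_getElem hk, work]
    · refine (conf_eq (by simp [TM.moveWork]) ?_).symm
      have : digitTape (D i) ((k : ℤ) + 1 - 1) = some (D i)[k] := by simp [digitTape]
      simp only [Nat.cast_add, Nat.cast_one, ← this, update_digitTape_self]

theorem steps_carry (x : List Bool) (q : A.State) (p : ℕ) (i : Fin (A.width + 1))
    (D : Fin (A.width + 1) → List Bool) (l r : List Bool) (he : l ++ incBits r = D i) :
    ReflTransGen (TM.Step A.toTM x) (A.conf (q, some (.carry, i)) p i l.length (l ++ r) D)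
      (A.conf (q, none) p i 0 (D i) D) := by
  induction r generalizing l with
  | nil =>
    refine .head ((step_work_iff ..).2 ⟨((q, some (.back, i)), some true, .stay), ?_, ?_⟩)
      (steps_back x q p i D (l.length + 1) (by rw [← he]; simp [incBits]))
    · simp [digitTape_length, work]
    · refine (conf_eq (by simp [TM.moveWork]) ?_).symm
      rw [← he, List.append_nil, update_digitTape_length]; rfl
  | cons b r ih =>
    cases b
    · refine .head ((step_work_iff ..).2 ⟨((q, some (.back, i)), some true, .stay), ?_, ?_⟩)
        (steps_back x q p i D (l.length + 1) (by rw [← he]; simp [incBits]))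
      · simp [digitTape_append_cons, work]
      · refine (conf_eq (by simp [TM.moveWork]) ?_).symm
        rw [← he, update_digitTape_cons]; rfl
    · refine .head ((step_work_iff ..).2 ⟨((q, some (.carry, i)), some false, .right), ?_, ?_⟩)
        (ih (l ++ [false]) (by rw [← he]; simp [incBits]))
      · simp [digitTape_append_cons, work]
      · refine (conf_eq (by simp [TM.moveWork]) ?_).symm
        rw [update_digitTape_cons]; simp

theorem steps_borrow (x : List Bool) (q : A.State) (p : ℕ) (i : Fin (A.width + 1))
    (D : Fin (A.width + 1) → List Bool) (l r : List Bool) (he : l ++ decBits r = D i)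
    (hr : 0 < bval r) :
    ReflTransGen (TM.Step A.toTM x) (A.conf (q, some (.borrow, i)) p i l.length (l ++ r) D)
      (A.conf (q, none) p i 0 (D i) D) := by
  induction r generalizing l with
  | nil => simp [bval] at hr
  | cons b r ih =>
    cases b
    · refine .head ((step_work_iff ..).2 ⟨((q, some (.borrow, i)), some true, .right), ?_, ?_⟩)
        (ih (l ++ [true]) (by rw [← he]; simp [decBits]) (by simpa [bval] using hr))
      · simp [digitTape_append_cons, work]
      · refine (conf_eq (by simp [TM.moveWork]) ?_).symm
        rw [update_digitTape_cons]; simp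
    · refine .head ((step_work_iff ..).2 ⟨((q, some (.back, i)), some false, .stay), ?_, ?_⟩)
        (steps_back x q p i D (l.length + 1) (by rw [← he]; simp [decBits]))
      · simp [digitTape_append_cons, work]
      · refine (conf_eq (by simp [TM.moveWork]) ?_).symm
        rw [← he, update_digitTape_cons]; rfl

theorem steps_test (x : List Bool) (q : A.State) (p : ℕ) (i : Fin (A.width + 1))
    (D : Fin (A.width + 1) → List Bool) (l r : List Bool) (he : l ++ r = D i)
    (hr : bval r = 0) :
    ReflTransGen (TM.Step A.toTM x) (A.conf (q, some (.test, i)) p i l.length (l ++ r) D)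
      (A.conf (q, none) p i 0 (D i) D) := by
  induction r generalizing l with
  | nil =>
    have he' : l = D i := by simpa using he
    refine .head ((step_work_iff ..).2 ⟨((q, some (.back, i)), none, .left), ?_, ?_⟩)
      (steps_back x q p i D l.length (by rw [← he']))
    · simp [digitTape_length, work]
    · refine (conf_eq (by simp [TM.moveWork]) ?_).symm
      have := digitTape_length l
      simp only [← this, List.append_nil, update_digitTape_self, he']
  | cons b r ih =>
    cases b
    · refine .head ((step_work_iff ..).2 ⟨((q, some (.test, i)), some false, .right), ?_, ?_⟩)
        (ih (l ++ [false]) (by rw [← he]; simp) (by simpa [bval] using hr))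
      · simp [digitTape_append_cons, work]
      · refine (conf_eq (by simp [TM.moveWork]) ?_).symm
        rw [update_digitTape_cons]; simp
    · simp [bval] at hr

/-- The final state is excluded because the Turing machine halts there, whereas a counter machine
may have rules that leave it. -/
theorem steps_of_step {x : List Bool} {q q' : A.State} {σ τ : Mem} (hq : q ≠ A.final)
    (h : A.Step x (q, σ) (q', τ)) (D : Fin (A.width + 1) → List Bool) (hD : Rep D σ.cnt) :
    ∃ D' : Fin (A.width + 1) → List Bool, Rep D' τ.cnt ∧
      ReflTransGen (TM.Step A.toTM x) (A.conf (q, none) σ.pos 0 0 (D 0) D)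
        (A.conf (q', none) τ.pos 0 0 (D' 0) D') := by
  obtain ⟨hop, he⟩ := h
  have hidx := A.index_le _ _ _ _ hop
  have first := fun i => (step_main_iff x q σ.pos i D _).2 ⟨hq, _, q', hop, rfl⟩
  cases he with
  | move d p c => exact ⟨D, hD, .single (first 0)⟩
  | inc j p c =>
    obtain ⟨j, rfl⟩ : ∃ j' : Fin (A.width + 1), (j' : ℕ) = j :=
      ⟨⟨j, Nat.lt_succ_of_le hidx⟩, rfl⟩
    refine ⟨Function.update D j (incBits (D j)),
      hD.update j (by rw [bval_incBits, hD]), ?_⟩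
    rw [conf_main _ _ 0 j, conf_main _ _ 0 j]
    refine .head (first j) ?_
    simp only [issue, Fin.ofNat_eq_cast, Fin.cast_val_eq_self]
    rw [← conf_update _ _ _ _ _ (incBits (D j))]
    exact steps_carry x q' p j _ [] (D j) (by simp)
  | dec j p v c hv =>
    obtain ⟨j, rfl⟩ : ∃ j' : Fin (A.width + 1), (j' : ℕ) = j :=
      ⟨⟨j, Nat.lt_succ_of_le hidx⟩, rfl⟩
    have h2 : bval (D j) = c j := hD j
    have h0 : 0 < bval (D j) := by omega
    have h1 := bval_decBits _ h0
    refine ⟨Function.update D j (decBits (D j)), hD.update j (by omega), ?_⟩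
    rw [conf_main _ _ 0 j, conf_main _ _ 0 j]
    refine .head (first j) ?_
    simp only [issue, Fin.ofNat_eq_cast, Fin.cast_val_eq_self]
    rw [← conf_update _ _ _ _ _ (decBits (D j))]
    exact steps_borrow x q' p j _ [] (D j) (by simp) h0
  | zero j p c hv =>
    obtain ⟨j, rfl⟩ : ∃ j' : Fin (A.width + 1), (j' : ℕ) = j :=
      ⟨⟨j, Nat.lt_succ_of_le hidx⟩, rfl⟩
    refine ⟨D, hD, ?_⟩
    rw [conf_main _ _ 0 j, conf_main _ _ 0 j]
    refine .head (first j) ?_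
    simp only [issue, Fin.ofNat_eq_cast, Fin.cast_val_eq_self]
    exact steps_test x q' p j _ [] (D j) (by simp) ((hD j).trans hv)

/-- The first alternative covers computations that pass through the final state earlier: there the
simulation has already stopped and accepted. -/
theorem occurs_of_reach {x : List Bool} {q : A.State} {σ : Mem}
    (h : A.Reach x (A.start, Mem.init) (q, σ)) :
    (∃ p D, TM.Occurs A.toTM x (A.conf (A.final, none) p 0 0 (D 0) D)) ∨
      ∃ D, Rep D σ.cnt ∧ TM.Occurs A.toTM x (A.conf (q, none) σ.pos 0 0 (D 0) D) := by
  simp only [TM.occurs_iff]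
  suffices H : ∀ s, A.Reach x (A.start, Mem.init) s →
      (∃ p D, ReflTransGen (TM.Step A.toTM x) (TM.init A.toTM)
        (A.conf (A.final, none) p 0 0 (D 0) D)) ∨
      ∃ D, Rep D s.2.cnt ∧ ReflTransGen (TM.Step A.toTM x) (TM.init A.toTM)
        (A.conf (s.1, none) s.2.pos 0 0 (D 0) D) from H _ h
  intro s hs
  induction hs with
  | refl => exact .inr ⟨fun _ => [], fun _ => rfl, by rw [init_eq 0]; exact .refl⟩
  | @tail s s' _ hstep ih =>
    rcases ih with ih | ⟨D, hD, ih⟩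
    · exact .inl ih
    · by_cases hq : s.1 = A.final
      · exact .inl ⟨_, D, hq ▸ ih⟩
      · obtain ⟨D', hD', h'⟩ := steps_of_step hq hstep D hD
        exact .inr ⟨D', hD', ih.trans h'⟩

theorem accepts_toTM_iff {x : List Bool}
    (hB : ∀ q τ, A.Reach x (A.start, Mem.init) (q, τ) → τ.Bdd x.length) :
    A.toTM.Accepts x ↔ ∃ τ, A.Reach x (A.start, Mem.init) (A.final, τ) := by
  constructor
  · rintro ⟨c, hc, -, hacc⟩
    have hst : c.state = (A.final, none) := hacc
    cases Inv.of_occurs hB hc with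
    | main i hr hD hs =>
      simp only [conf, Prod.mk.injEq] at hst
      exact ⟨_, hst.1 ▸ hr⟩
    | _ => simp [conf] at hst
  · rintro ⟨τ, hτ⟩
    obtain ⟨p, D, h⟩ : ∃ p D, TM.Occurs A.toTM x (A.conf (A.final, none) p 0 0 (D 0) D) := by
      rcases occurs_of_reach hτ with h | ⟨D, -, h⟩
      · exact h
      · exact ⟨_, D, h⟩
    refine ⟨_, h, ?_, rfl⟩
    rw [TM.Halted, Set.eq_empty_iff_forall_notMem]
    rintro μ ⟨hne, -⟩
    exact hne rfl

theorem usesSpace_toTM {x : List Bool}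
    (hB : ∀ q τ, A.Reach x (A.start, Mem.init) (q, τ) → τ.Bdd x.length) :
    A.toTM.UsesSpace x (4 * Real.logb 2 x.length + 4) := by
  -- For `n ≥ 1` one has `2 (n + 1) ≤ 4 n`, so the length is at most `2 + log n`. For `n = 0` the
  -- convention `logb 2 0 = 0` leaves the additive constant, and the length is at most `1`.
  have key : ∀ d : List Bool, 2 ^ d.length ≤ 2 * (x.length + 1) →
      ((d.length + 1 : ℕ) : ℝ) ≤ 4 * Real.logb 2 x.length + 4 := by
    intro d hd
    rcases Nat.eq_zero_or_pos x.length with h0 | h0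
    · rw [h0] at hd ⊢
      have : d.length ≤ 1 := by
        by_contra hlt
        have : 2 ^ 2 ≤ 2 ^ d.length := Nat.pow_le_pow_right (by norm_num) (by omega)
        omega
      have h2 : ((d.length + 1 : ℕ) : ℝ) ≤ 2 := by exact_mod_cast Nat.succ_le_succ this
      simp only [Nat.cast_zero, Real.logb_zero]
      linarith
    · have h1 : (1 : ℝ) ≤ x.length := by exact_mod_cast h0
      have h2 : (2 : ℝ) ^ d.length ≤ 2 ^ (2 : ℝ) * x.length := by
        have : (2 : ℝ) ^ d.length ≤ 2 * (x.length + 1) := by exact_mod_cast hd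
        norm_num
        linarith
      have h3 : (d.length : ℝ) ≤ 2 + Real.logb 2 x.length := by
        have := Real.logb_le_logb_of_le (b := 2) (by norm_num) (by positivity) h2
        rwa [Real.logb_mul (by positivity) (by positivity), Real.logb_rpow (by norm_num)
          (by norm_num), ← Real.rpow_natCast, Real.logb_rpow (by norm_num) (by norm_num)] at this
      have h4 : 0 ≤ Real.logb 2 x.length := Real.logb_nonneg (by norm_num) h1
      push_cast
      linarith
  -- The extra `1` covers the head in cell `-1`.
  have key' : ∀ (i j : Fin (A.width + 1)) (h : ℤ) (d : List Bool),
      h.natAbs ≤ d.length + 1 → 2 ^ d.length ≤ 2 * (x.length + 1) →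
      (((Function.update (fun _ => (0 : ℤ)) i h j).natAbs : ℕ) : ℝ) ≤
        4 * Real.logb 2 x.length + 4 := by
    intro i j h d h1 h2
    refine le_trans (Nat.cast_le.2 ?_) (key d h2)
    by_cases hj : j = i
    · subst hj; simpa using h1
    · simp [hj]
  intro c hc i
  cases Inv.of_occurs hB hc with
  | main j hr hD hs => exact key' _ _ _ _ (by simp) (hs j)
  | @back q p c D j h hr hD hs h1 h2 => exact key' _ _ _ (D j) (by omega) (hs j)
  | @carry q p c D j l r hr hD hs he =>
    refine key' _ _ _ (D j) ?_ (hs j)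
    simp only [Int.natAbs_natCast, ← he, List.length_append]; omega
  | @borrow q p c D j l r hr hs he =>
    refine key' _ _ _ (D j) ?_ (hs j)
    simp only [Int.natAbs_natCast, ← he, List.length_append]; omega
  | @test q p c D j l r hr hD hs he =>
    refine key' _ _ _ (D j) ?_ (hs j)
    simp only [Int.natAbs_natCast, ← he, List.length_append]; omega

/-- A counter machine whose counters are at most `n + 1` accepts a language in `NL`. -/
theorem mem_NL
    (hB : ∀ x q τ, A.Reach x (A.start, Mem.init) (q, τ) → τ.Bdd x.length) :
    ({x | ∃ τ, A.Reach x (A.start, Mem.init) (A.final, τ)} : Set (List Bool)) ∈ NL :=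
  ⟨A.toTM, fun x => accepts_toTM_iff (hB x), 4, fun x => usesSpace_toTM (hB x)⟩

end CounterMachine
end Machine

namespace Machine

open Relation (ReflTransGen)

/-! ### Nondeterministic programs -/

/-- Nondeterministic programs for an input head and counters. -/
inductive Prog where
  | move (s : InSym → Prop) (d : Dir)
  | dec (i : ℕ)
  | zero (i : ℕ)
  | load (i : ℕ)
  | seq (P Q : Prog)
  | alt (P Q : Prog)
  | star (P : Prog)

/-- The relation between the memory before and after the execution of a program: `move s d` moves
the head if it scans a symbol in `s`, and `load i` adds the number of a run of ones to the right of
the head to the counter `i`, which has to be `0`. -/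
def Prog.den (x : List Bool) : Prog → Mem → Mem → Prop
  | move s d, σ, τ => s (TM.inputAt x σ.pos) ∧ τ = ⟨TM.moveIn x.length d σ.pos, σ.cnt⟩
  | dec i, σ, τ => ∃ v, σ.cnt i = v + 1 ∧ τ = ⟨σ.pos, Function.update σ.cnt i v⟩
  | zero i, σ, τ => σ.cnt i = 0 ∧ τ = σ
  | load i, σ, τ => σ.cnt i = 0 ∧ ∃ j, (∀ l < j, TM.inputAt x (σ.pos + l) = InSym.bit true) ∧
      τ = ⟨σ.pos + j, Function.update σ.cnt i j⟩
  | seq P Q, σ, τ => ∃ ρ, P.den x σ ρ ∧ Q.den x ρ τ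
  | alt P Q, σ, τ => P.den x σ τ ∨ Q.den x σ τ
  | star P, σ, τ => ReflTransGen (P.den x) σ τ

theorem TM.pos_of_inputAt {x : List Bool} {p : ℕ} {b : Bool} (h : inputAt x p = .bit b) :
    1 ≤ p ∧ p ≤ x.length ∧ x[p - 1]? = some b := by
  unfold inputAt at h
  split_ifs at h with h0
  · split at h
    · rename_i b' hb
      have : b' = b := by simpa using h
      subst this
      have := (List.getElem?_eq_some_iff.1 hb).1
      exact ⟨by omega, by omega, hb⟩
    · simp at h

theorem TM.inputAt_eq_bit {x : List Bool} {p : ℕ} {b : Bool} (h0 : 1 ≤ p)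
    (h : x[p - 1]? = some b) : inputAt x p = .bit b := by
  unfold inputAt
  rw [if_neg (by omega), h]

theorem Op.eff_stay {n : ℕ} {σ τ : Mem} : (Op.move .stay).Eff n σ τ ↔ τ = σ := by
  constructor
  · rintro ⟨⟩; rfl
  · rintro rfl; exact .move .stay _ _

/-! ### Compiling programs to counter machines -/

namespace CounterMachine

/-- The machine `A` executes the program `P` and keeps counters bounded. -/
def Implements (A : CounterMachine) (P : Prog) : Prop :=
  ∀ x σ, (∀ τ, A.Reach x (A.start, σ) (A.final, τ) ↔ P.den x σ τ) ∧
    (σ.Bdd x.length → ∀ q τ, A.Reach x (A.start, σ) (q, τ) → τ.Bdd x.length)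

theorem Reach.map {A B : CounterMachine} (f : A.State → B.State)
    (hf : ∀ q a o q', A.rules q a o q' → B.rules (f q) a o (f q')) {x : List Bool} {q q' : A.State}
    {σ τ : Mem} (h : A.Reach x (q, σ) (q', τ)) : B.Reach x (f q, σ) (f q', τ) := by
  suffices H : ∀ s t, A.Reach x s t → B.Reach x (f s.1, s.2) (f t.1, t.2) from H _ _ h
  intro s t h
  induction h with
  | refl => exact .refl
  | tail _ h ih =>
    obtain ⟨hr, he⟩ := h
    exact ih.tail (.mk (hf _ _ _ _ hr) he)

theorem step_stay (A : CounterMachine) (q q' : A.State) {x : List Bool} {σ : Mem}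
    (h : A.rules q (TM.inputAt x σ.pos) (.move .stay) q') : A.Step x (q, σ) (q', σ) :=
  .mk h (Op.eff_stay.2 rfl)

/-- The machine that can execute a single instruction. -/
abbrev basic (s : InSym → Prop) (op : Op) : CounterMachine where
  State := Bool
  finState := inferInstance
  start := false
  final := true
  rules q a o q' := q = false ∧ s a ∧ o = op ∧ q' = true
  width := op.index
  index_le := by rintro q a o q' ⟨-, -, rfl, -⟩; exact le_rfl

theorem reach_basic {s : InSym → Prop} {op : Op} {x : List Bool} {σ : Mem} {t : Bool × Mem} :
    (basic s op).Reach x (false, σ) t ↔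
      t = (false, σ) ∨ t.1 = true ∧ s (TM.inputAt x σ.pos) ∧ op.Eff x.length σ t.2 := by
  constructor
  · intro h
    induction h with
    | refl => exact .inl rfl
    | tail _ h ih =>
      obtain ⟨⟨hq, hs, rfl, rfl⟩, he⟩ := h
      rcases ih with ih | ih
      · cases ih
        exact .inr ⟨rfl, hs, he⟩
      · exact absurd (ih.1.symm.trans hq) (by simp)
  · rintro (rfl | ⟨h1, h2, h3⟩)
    · exact .refl
    · obtain ⟨q, τ⟩ := t
      cases h1
      exact .single (.mk ⟨rfl, h2, rfl, rfl⟩ h3)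

theorem implements_basic {s : InSym → Prop} {op : Op} {P : Prog}
    (h : ∀ x σ τ, P.den x σ τ ↔ s (TM.inputAt x σ.pos) ∧ op.Eff x.length σ τ)
    (hb : ∀ n σ τ, op.Eff n σ τ → σ.Bdd n → τ.Bdd n) : (basic s op).Implements P := by
  refine fun x σ => ⟨fun τ => ?_, fun hσ q τ hr => ?_⟩
  · rw [h]
    refine reach_basic.trans ?_
    simp [basic]
  · rcases reach_basic.1 hr with hr | ⟨-, -, hr⟩
    · cases hr; exact hσ
    · exact hb _ _ _ hr hσ

/-- State `2` lies between counting a one and moving past it. State `1` is final, so the loader may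
stop anywhere in the run of ones. -/
inductive LoadRules (i : ℕ) : Fin 3 → InSym → Op → Fin 3 → Prop
  | enter (a) : LoadRules i 0 a (.zero i) 1
  | inc : LoadRules i 1 (.bit true) (.inc i) 2
  | move (a) : LoadRules i 2 a (.move .right) 1

/-- The machine that loads a run of ones. -/
abbrev loader (i : ℕ) : CounterMachine where
  State := Fin 3
  finState := inferInstance
  start := 0
  final := 1
  rules := LoadRules i
  width := i
  index_le := by rintro q a o q' (_ | _ | _) <;> simp [Op.index]

theorem reach_loader_sound {i : ℕ} {x : List Bool} {σ : Mem} {t : Fin 3 × Mem}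
    (h : (loader i).Reach x (0, σ) t) :
    t = (0, σ) ∨ σ.cnt i = 0 ∧ ∃ j, (∀ l < j, TM.inputAt x (σ.pos + l) = InSym.bit true) ∧
      (t = (1, ⟨σ.pos + j, Function.update σ.cnt i j⟩) ∨
        t = (2, ⟨σ.pos + j, Function.update σ.cnt i (j + 1)⟩) ∧
          TM.inputAt x (σ.pos + j) = InSym.bit true) := by
  induction h with
  | refl => exact .inl rfl
  | tail _ h ih =>
    rcases ih with rfl | ⟨h0, j, hj, rfl | ⟨rfl, hb⟩⟩
    · obtain ⟨hr, he⟩ := h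
      cases hr
      cases he with
      | zero _ _ _ h0 => exact .inr ⟨h0, 0, by simp, .inl (by simp [← h0])⟩
    · generalize hτ : (⟨σ.pos + j, Function.update σ.cnt i j⟩ : Mem) = τ at h
      obtain ⟨hr, he⟩ := h
      have hb : TM.inputAt x (σ.pos + j) = InSym.bit true := by
        rw [← hτ] at hr
        generalize TM.inputAt x _ = a at hr ⊢
        cases hr
        rfl
      generalize TM.inputAt x _ = a at hr
      cases hr
      cases he
      cases hτ
      exact .inr ⟨h0, j, hj, .inr ⟨by simp, hb⟩⟩
    · generalize hτ : (⟨σ.pos + j, Function.update σ.cnt i (j + 1)⟩ : Mem) = τ at h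
      obtain ⟨hr, he⟩ := h
      generalize TM.inputAt x τ.pos = a at hr
      cases hr
      cases he
      cases hτ
      refine .inr ⟨h0, j + 1, fun l hl => ?_, .inl ?_⟩
      · rcases Nat.lt_succ_iff_lt_or_eq.1 hl with hl | rfl
        · exact hj l hl
        · exact hb
      · have := (TM.pos_of_inputAt hb).2.1
        simp only [TM.moveIn]
        rw [min_eq_left (by omega), add_assoc]

theorem implements_loader (i : ℕ) : (loader i).Implements (.load i) := by
  refine fun x σ => ⟨fun τ => ⟨fun h => ?_, ?_⟩, fun hσ q τ hr => ?_⟩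
  · rcases reach_loader_sound h with h | ⟨h0, j, hj, h | ⟨h, -⟩⟩
    · simp [loader] at h
    · exact ⟨h0, j, hj, (Prod.mk.inj h).2⟩
    · simp [loader] at h
  · rintro ⟨h0, j, hj, rfl⟩
    induction j with
    | zero =>
      refine .single (.mk (.enter _) ?_)
      rw [add_zero, Function.update_eq_self_iff.2 h0.symm]
      exact .zero _ _ _ h0
    | succ j ih =>
      have hb := hj j (by omega)
      have h2 : (loader i).Step x (1, ⟨σ.pos + j, Function.update σ.cnt i j⟩)
          (2, ⟨σ.pos + j, _⟩) := .mk (by rw [hb]; exact .inc) (.inc _ _ _)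
      refine (ReflTransGen.tail (ih fun l hl => hj l (by omega)) h2).tail (.mk (.move _) ?_)
      have := (TM.pos_of_inputAt hb).2.1
      have h1 : TM.moveIn x.length .right (σ.pos + j) = σ.pos + (j + 1) := by
        simp only [TM.moveIn]
        rw [min_eq_left (by omega), add_assoc]
      rw [← h1]
      simp only [Function.update_idem, Function.update_self]
      exact .move _ _ _
  · have key : ∀ p v, v ≤ x.length + 1 → Mem.Bdd x.length ⟨p, Function.update σ.cnt i v⟩ := by
      intro p v hv k
      by_cases hk : k = i
      · subst hk; simpa using hv
      · simpa [hk] using hσ k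
    -- A run of ones lies between the end-markers. In state `2` the counter is one ahead of `j`,
    -- which the bound `n + 1` accommodates.
    have hle : ∀ j, (∀ l < j, TM.inputAt x (σ.pos + l) = InSym.bit true) → j ≤ x.length := by
      intro j hj
      rcases j with _ | j
      · simp
      · have := TM.pos_of_inputAt (hj j (by omega))
        have := TM.pos_of_inputAt (hj 0 (by omega))
        omega
    rcases reach_loader_sound hr with h | ⟨h0, j, hj, h | ⟨h, -⟩⟩
    · cases h; exact hσ
    · cases h; exact key _ _ (by have := hle j hj; omega)
    · cases h; exact key _ _ (by have := hle j hj; omega)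

/-- The execution of two machines one after the other. -/
abbrev seq (A B : CounterMachine) : CounterMachine where
  State := A.State ⊕ B.State
  finState := by
    have := A.finState
    have := B.finState
    infer_instance
  start := .inl A.start
  final := .inr B.final
  rules
    | .inl q, a, o, .inl q' => A.rules q a o q'
    | .inl q, _, o, .inr q' => q = A.final ∧ q' = B.start ∧ o = .move .stay
    | .inr _, _, _, .inl _ => False
    | .inr q, a, o, .inr q' => B.rules q a o q'
  width := max A.width B.width
  index_le := by
    rintro (q | q) a o (q' | q') h
    · exact le_max_of_le_left (A.index_le _ _ _ _ h)
    · rw [h.2.2]; simp [Op.index]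
    · exact h.elim
    · exact le_max_of_le_right (B.index_le _ _ _ _ h)

/-- No rule leads from the second machine back to the first, so a computation splits at the single
crossing. Intermediate states are described as well because bounds on counters are required there
too. -/
theorem reach_seq_iff {A B : CounterMachine} {x : List Bool} {σ : Mem} {q : (A.seq B).State}
    {τ : Mem} :
    (A.seq B).Reach x (.inl A.start, σ) (q, τ) ↔
      (∃ q', q = .inl q' ∧ A.Reach x (A.start, σ) (q', τ)) ∨
      ∃ q' ρ, q = .inr q' ∧ A.Reach x (A.start, σ) (A.final, ρ) ∧
        B.Reach x (B.start, ρ) (q', τ) := by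
  constructor
  · intro h
    generalize ht : (q, τ) = t at h
    induction h generalizing q τ with
    | refl => cases ht; exact .inl ⟨_, rfl, .refl⟩
    | tail _ h ih =>
      subst ht
      obtain ⟨hr, he⟩ := h
      rcases ih rfl with ⟨q', rfl, k1⟩ | ⟨q', ρ, rfl, k1, k2⟩
      · rcases q with q | q
        · exact .inl ⟨_, rfl, k1.tail (.mk hr he)⟩
        · obtain ⟨rfl, rfl, rfl⟩ := hr
          obtain rfl := Op.eff_stay.1 he
          exact .inr ⟨_, _, rfl, k1, .refl⟩
      · rcases q with q | q
        · exact hr.elim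
        · exact .inr ⟨_, _, rfl, k1, k2.tail (.mk hr he)⟩
  · have hA : ∀ {q τ}, A.Reach x (A.start, σ) (q, τ) →
        (A.seq B).Reach x (.inl A.start, σ) (.inl q, τ) := fun h =>
      h.map (B := A.seq B) Sum.inl (fun _ _ _ _ h => h)
    have hB : ∀ {ρ q τ}, B.Reach x (B.start, ρ) (q, τ) →
        (A.seq B).Reach x (.inr B.start, ρ) (.inr q, τ) := fun h =>
      h.map (B := A.seq B) Sum.inr (fun _ _ _ _ h => h)
    rintro (⟨q', rfl, h⟩ | ⟨q', ρ, rfl, h, h'⟩)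
    · exact hA h
    · exact ((hA h).tail (step_stay (A.seq B) (.inl A.final) (.inr B.start) ⟨rfl, rfl, rfl⟩)).trans
        (hB h')

theorem Implements.seq {A B : CounterMachine} {P Q : Prog} (hA : A.Implements P)
    (hB : B.Implements Q) : (A.seq B).Implements (.seq P Q) := by
  refine fun x σ => ⟨fun τ => reach_seq_iff.trans ?_, fun hσ q τ hr => ?_⟩
  · simp [CounterMachine.seq, Prog.den, (hA x _).1, (hB x _).1]
  · rcases reach_seq_iff.1 hr with ⟨q', rfl, h⟩ | ⟨q', ρ, rfl, h, h'⟩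
    · exact (hA x σ).2 hσ _ _ h
    · exact (hB x ρ).2 ((hA x σ).2 hσ _ _ h) _ _ h'

/-- The execution of one of two machines. -/
abbrev alt (A B : CounterMachine) : CounterMachine where
  State := Bool ⊕ (A.State ⊕ B.State)
  finState := by
    have := A.finState
    have := B.finState
    infer_instance
  start := .inl false
  final := .inl true
  rules
    | .inl b, _, o, .inr (.inl q') => b = false ∧ q' = A.start ∧ o = .move .stay
    | .inl b, _, o, .inr (.inr q') => b = false ∧ q' = B.start ∧ o = .move .stay
    | .inr (.inl q), a, o, .inr (.inl q') => A.rules q a o q'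
    | .inr (.inr q), a, o, .inr (.inr q') => B.rules q a o q'
    | .inr (.inl q), _, o, .inl b => q = A.final ∧ b = true ∧ o = .move .stay
    | .inr (.inr q), _, o, .inl b => q = B.final ∧ b = true ∧ o = .move .stay
    | _, _, _, _ => False
  width := max A.width B.width
  index_le := by
    rintro (b | q | q) a o (b' | q' | q') h
    · exact h.elim
    · rw [h.2.2]; simp [Op.index]
    · rw [h.2.2]; simp [Op.index]
    · rw [h.2.2]; simp [Op.index]
    · exact le_max_of_le_left (A.index_le _ _ _ _ h)
    · exact h.elim
    · rw [h.2.2]; simp [Op.index]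
    · exact h.elim
    · exact le_max_of_le_right (B.index_le _ _ _ _ h)

/-- The start and final states are new: nothing enters the former or leaves the latter. A
computation therefore commits to one machine. -/
theorem reach_alt_iff {A B : CounterMachine} {x : List Bool} {σ : Mem}
    {q : (A.alt B).State} {τ : Mem} :
    (A.alt B).Reach x (.inl false, σ) (q, τ) ↔
      (q = .inl false ∧ τ = σ) ∨
      (∃ q', q = .inr (.inl q') ∧ A.Reach x (A.start, σ) (q', τ)) ∨
      (∃ q', q = .inr (.inr q') ∧ B.Reach x (B.start, σ) (q', τ)) ∨
      (q = .inl true ∧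
        (A.Reach x (A.start, σ) (A.final, τ) ∨ B.Reach x (B.start, σ) (B.final, τ))) := by
  constructor
  · intro h
    generalize ht : (q, τ) = t at h
    induction h generalizing q τ with
    | refl => cases ht; exact .inl ⟨rfl, rfl⟩
    | tail _ h ih =>
      subst ht
      obtain ⟨hr, he⟩ := h
      rcases ih rfl with ⟨rfl, rfl⟩ | ⟨q', rfl, k1⟩ | ⟨q', rfl, k1⟩ | ⟨rfl, k1⟩
      · rcases q with b | q | q
        · exact hr.elim
        · obtain ⟨-, rfl, rfl⟩ := hr
          obtain rfl := Op.eff_stay.1 he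
          exact .inr (.inl ⟨_, rfl, .refl⟩)
        · obtain ⟨-, rfl, rfl⟩ := hr
          obtain rfl := Op.eff_stay.1 he
          exact .inr (.inr (.inl ⟨_, rfl, .refl⟩))
      · rcases q with b | q | q
        · obtain ⟨rfl, rfl, rfl⟩ := hr
          obtain rfl := Op.eff_stay.1 he
          exact .inr (.inr (.inr ⟨rfl, .inl k1⟩))
        · exact .inr (.inl ⟨_, rfl, k1.tail (.mk hr he)⟩)
        · exact hr.elim
      · rcases q with b | q | q
        · obtain ⟨rfl, rfl, rfl⟩ := hr
          obtain rfl := Op.eff_stay.1 he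
          exact .inr (.inr (.inr ⟨rfl, .inr k1⟩))
        · exact hr.elim
        · exact .inr (.inr (.inl ⟨_, rfl, k1.tail (.mk hr he)⟩))
      · rcases q with b | q | q
        · exact hr.elim
        · exact absurd hr.1 (by simp)
        · exact absurd hr.1 (by simp)
  · have hA : ∀ {q τ}, A.Reach x (A.start, σ) (q, τ) →
        (A.alt B).Reach x (.inl false, σ) (.inr (.inl q), τ) := fun h =>
      .head (step_stay (A.alt B) (.inl false) (.inr (.inl A.start)) ⟨rfl, rfl, rfl⟩)
        (h.map (B := A.alt B) (fun q => Sum.inr (Sum.inl q)) (fun _ _ _ _ h => h))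
    have hB : ∀ {q τ}, B.Reach x (B.start, σ) (q, τ) →
        (A.alt B).Reach x (.inl false, σ) (.inr (.inr q), τ) := fun h =>
      .head (step_stay (A.alt B) (.inl false) (.inr (.inr B.start)) ⟨rfl, rfl, rfl⟩)
        (h.map (B := A.alt B) (fun q => Sum.inr (Sum.inr q)) (fun _ _ _ _ h => h))
    rintro (⟨rfl, rfl⟩ | ⟨q', rfl, h⟩ | ⟨q', rfl, h⟩ | ⟨rfl, h | h⟩)
    · exact .refl
    · exact hA h
    · exact hB h
    · exact (hA h).tail (step_stay (A.alt B) (.inr (.inl A.final)) (.inl true) ⟨rfl, rfl, rfl⟩)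
    · exact (hB h).tail (step_stay (A.alt B) (.inr (.inr B.final)) (.inl true) ⟨rfl, rfl, rfl⟩)

theorem Implements.alt {A B : CounterMachine} {P Q : Prog} (hA : A.Implements P)
    (hB : B.Implements Q) : (A.alt B).Implements (.alt P Q) := by
  refine fun x σ => ⟨fun τ => reach_alt_iff.trans ?_, fun hσ q τ hr => ?_⟩
  · simp [CounterMachine.alt, Prog.den, (hA x _).1, (hB x _).1]
  · rcases reach_alt_iff.1 hr with ⟨-, rfl⟩ | ⟨q', -, h⟩ | ⟨q', -, h⟩ | ⟨-, h | h⟩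
    · exact hσ
    · exact (hA x σ).2 hσ _ _ h
    · exact (hB x σ).2 hσ _ _ h
    · exact (hA x σ).2 hσ _ _ h
    · exact (hB x σ).2 hσ _ _ h

/-- The repeated execution of a machine. -/
abbrev star (A : CounterMachine) : CounterMachine where
  State := Option A.State
  finState := by
    have := A.finState
    infer_instance
  start := none
  final := none
  rules
    | none, _, _, none => False
    | none, _, o, some q' => q' = A.start ∧ o = .move .stay
    | some q, _, o, none => q = A.final ∧ o = .move .stay
    | some q, a, o, some q' => A.rules q a o q'
  width := A.width
  index_le := by
    rintro (_ | q) a o (_ | q') h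
    · exact h.elim
    · rw [h.2]; simp [Op.index]
    · rw [h.2]; simp [Op.index]
    · exact A.index_le _ _ _ _ h

/-- Cutting a computation at its visits to `none` gives complete rounds, each of which is an
execution of `P`, followed by at most one unfinished round. -/
theorem reach_star_iff {A : CounterMachine} {P : Prog} (hA : A.Implements P) {x : List Bool}
    {σ : Mem} {q : A.star.State} {τ : Mem} :
    A.star.Reach x (none, σ) (q, τ) ↔
      (q = none ∧ ReflTransGen (P.den x) σ τ) ∨
      ∃ q' ρ, q = some q' ∧ ReflTransGen (P.den x) σ ρ ∧ A.Reach x (A.start, ρ) (q', τ) := by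
  constructor
  · intro h
    generalize ht : (q, τ) = t at h
    induction h generalizing q τ with
    | refl => cases ht; exact .inl ⟨rfl, .refl⟩
    | tail _ h ih =>
      subst ht
      obtain ⟨hr, he⟩ := h
      rcases ih rfl with ⟨rfl, k1⟩ | ⟨q', ρ, rfl, k1, k2⟩
      · rcases q with _ | q
        · exact hr.elim
        · obtain ⟨rfl, rfl⟩ := hr
          obtain rfl := Op.eff_stay.1 he
          exact .inr ⟨_, _, rfl, k1, .refl⟩
      · rcases q with _ | q
        · obtain ⟨rfl, rfl⟩ := hr
          obtain rfl := Op.eff_stay.1 he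
          exact .inl ⟨rfl, k1.tail (((hA x _).1 _).1 k2)⟩
        · exact .inr ⟨_, _, rfl, k1, k2.tail (.mk hr he)⟩
  · have hin : ∀ {ρ q τ}, A.Reach x (A.start, ρ) (q, τ) →
        A.star.Reach x (none, ρ) (some q, τ) := fun h =>
      .head (step_stay A.star none (some A.start) ⟨rfl, rfl⟩)
        (h.map (B := A.star) some (fun _ _ _ _ h => h))
    have hloop : ∀ {ρ}, ReflTransGen (P.den x) σ ρ → A.star.Reach x (none, σ) (none, ρ) := by
      intro ρ h
      induction h with
      | refl => exact .refl
      | tail _ h ih =>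
        exact (ih.trans (hin (((hA x _).1 _).2 h))).tail
          (step_stay A.star (some A.final) none ⟨rfl, rfl⟩)
    rintro (⟨rfl, h⟩ | ⟨q', ρ, rfl, h, h'⟩)
    · exact hloop h
    · exact (hloop h).trans (hin h')

theorem Implements.star {A : CounterMachine} {P : Prog} (hA : A.Implements P) :
    A.star.Implements (.star P) := by
  refine fun x σ => ⟨fun τ => (reach_star_iff hA).trans ?_, fun hσ q τ hr => ?_⟩
  · simp [CounterMachine.star, Prog.den]
  · have hb : ∀ {ρ}, ReflTransGen (P.den x) σ ρ → ρ.Bdd x.length := by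
      intro ρ h
      induction h with
      | refl => exact hσ
      | tail _ h ih => exact (hA x _).2 ih _ _ (((hA x _).1 _).2 h)
    rcases (reach_star_iff hA).1 hr with ⟨-, h⟩ | ⟨q', ρ, -, h, h'⟩
    · exact hb h
    · exact (hA x _).2 (hb h) _ _ h'

end CounterMachine

theorem Prog.exists_implements (P : Prog) : ∃ A : CounterMachine, A.Implements P := by
  induction P with
  | move s d =>
    refine ⟨.basic s (.move d), CounterMachine.implements_basic (fun x σ τ => ?_) ?_⟩
    · refine and_congr_right fun _ => ⟨?_, ?_⟩
      · rintro rfl; exact .move _ _ _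
      · rintro ⟨⟩; rfl
    · rintro n σ τ ⟨⟩ h; exact h
  | dec i =>
    refine ⟨.basic (fun _ => True) (.dec i), CounterMachine.implements_basic (fun x σ τ => ?_) ?_⟩
    · rw [true_and]
      constructor
      · rintro ⟨v, hv, rfl⟩; exact .dec _ _ _ _ hv
      · rintro ⟨⟩; exact ⟨_, ‹_›, rfl⟩
    · rintro n σ τ ⟨⟩ h k
      rename_i p v c hv
      by_cases hk : k = i
      · subst hk
        have := h k
        simp only [hv] at this
        simp only [Function.update_self]
        omega
      · simpa [hk] using h k
  | zero i =>
    refine ⟨.basic (fun _ => True) (.zero i), CounterMachine.implements_basic (fun x σ τ => ?_) ?_⟩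
    · rw [true_and]
      constructor
      · rintro ⟨h, rfl⟩; exact .zero _ _ _ h
      · rintro ⟨⟩; exact ⟨‹_›, rfl⟩
    · rintro n σ τ ⟨⟩ h; exact h
  | load i => exact ⟨_, CounterMachine.implements_loader i⟩
  | seq P Q hP hQ =>
    obtain ⟨A, hA⟩ := hP
    obtain ⟨B, hB⟩ := hQ
    exact ⟨_, hA.seq hB⟩
  | alt P Q hP hQ =>
    obtain ⟨A, hA⟩ := hP
    obtain ⟨B, hB⟩ := hQ
    exact ⟨_, hA.alt hB⟩
  | star P hP =>
    obtain ⟨A, hA⟩ := hP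
    exact ⟨_, hA.star⟩

/-- The inputs on which a program can be executed to its end form a language in `NL`. -/
theorem Prog.mem_NL (P : Prog) :
    ({x | ∃ τ, P.den x Mem.init τ} : Set (List Bool)) ∈ NL := by
  obtain ⟨A, hA⟩ := P.exists_implements
  have := A.mem_NL fun x q τ h => (hA x Mem.init).2 (fun _ => Nat.zero_le _) q τ h
  simpa only [(hA _ _).1] using this

end Machine

namespace Machine

open Relation (ReflTransGen)
open Factored (encodeNats)

/-! ### Reading tokens -/

/-- The position of the input head when the tokens `l` are still to be read. -/
def posOf (x : List Bool) (l : List ℕ) : ℕ := x.length + 1 - (encodeNats l).length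

theorem encodeNats_cons (a : ℕ) (l : List ℕ) :
    encodeNats (a :: l) = List.replicate a true ++ false :: encodeNats l := by
  simp [encodeNats]

theorem encodeNats_append (l l' : List ℕ) :
    encodeNats (l ++ l') = encodeNats l ++ encodeNats l' := by
  simp [encodeNats]

theorem suffix_of_append {x : List Bool} {l l' : List ℕ} (h : encodeNats (l ++ l') <:+ x) :
    encodeNats l' <:+ x := by
  rw [encodeNats_append] at h
  exact (List.suffix_append _ _).trans h

theorem suffix_of_cons {x : List Bool} {a : ℕ} {l : List ℕ} (h : encodeNats (a :: l) <:+ x) :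
    encodeNats l <:+ x := suffix_of_append (l := [a]) h

section Token

variable {x : List Bool} {a : ℕ} {l : List ℕ} (h : encodeNats (a :: l) <:+ x)
include h

theorem posOf_pos : 1 ≤ posOf x (a :: l) := by
  have := h.length_le
  unfold posOf; omega

theorem posOf_tail : posOf x l = posOf x (a :: l) + a + 1 := by
  have := h.length_le
  unfold posOf
  simp only [encodeNats_cons, List.length_append, List.length_replicate, List.length_cons] at *
  omega

theorem posOf_add_le : posOf x (a :: l) + a ≤ x.length := by
  have := h.length_le
  unfold posOf
  simp only [encodeNats_cons, List.length_append, List.length_replicate, List.length_cons] at *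
  omega

theorem inputAt_token_lt {j : ℕ} (hj : j < a) :
    TM.inputAt x (posOf x (a :: l) + j) = .bit true := by
  have h1 := posOf_pos h
  refine TM.inputAt_eq_bit (by omega) ?_
  obtain ⟨pre, rfl⟩ := h
  have : posOf (pre ++ encodeNats (a :: l)) (a :: l) = pre.length + 1 := by
    simp [posOf]; omega
  rw [this, encodeNats_cons, List.getElem?_append_right (by omega),
    List.getElem?_append_left (by simp; omega), List.getElem?_replicate, if_pos (by omega)]

theorem inputAt_token_end : TM.inputAt x (posOf x (a :: l) + a) = .bit false := by
  have h1 := posOf_pos h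
  refine TM.inputAt_eq_bit (by omega) ?_
  obtain ⟨pre, rfl⟩ := h
  have : posOf (pre ++ encodeNats (a :: l)) (a :: l) = pre.length + 1 := by
    simp [posOf]; omega
  rw [this, encodeNats_cons, List.getElem?_append_right (by omega),
    List.getElem?_append_right (by simp)]
  have : pre.length + 1 + a - 1 - pre.length - (List.replicate a true).length = 0 := by
    simp
  rw [this]; rfl

/-- Guessing the length of a unary token leaves no freedom once its end is checked: a shorter guess
sees a one, and a longer one would cross the closing zero. -/
theorem token_unique {j : ℕ} (hj : ∀ i < j, TM.inputAt x (posOf x (a :: l) + i) = .bit true)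
    (he : TM.inputAt x (posOf x (a :: l) + j) = .bit false) : j = a := by
  rcases lt_trichotomy j a with hlt | rfl | hlt
  · rw [inputAt_token_lt h hlt] at he; simp at he
  · rfl
  · have := hj a hlt
    rw [inputAt_token_end h] at this; simp at this

end Token

/-! ### Programs for single tokens -/

namespace Prog

theorem den_seq {x : List Bool} {P Q : Prog} {σ τ : Mem} :
    (seq P Q).den x σ τ ↔ ∃ ρ, P.den x σ ρ ∧ Q.den x ρ τ := Iff.rfl

theorem den_alt {x : List Bool} {P Q : Prog} {σ τ : Mem} :
    (alt P Q).den x σ τ ↔ P.den x σ τ ∨ Q.den x σ τ := Iff.rfl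

def nop : Prog := move (fun _ => True) .stay

def fail : Prog := move (fun _ => False) .stay

theorem den_nop {x : List Bool} {σ τ : Mem} : nop.den x σ τ ↔ τ = σ := by
  simp [nop, den, TM.moveIn]

theorem den_fail {x : List Bool} {σ τ : Mem} : ¬ fail.den x σ τ := by
  simp [fail, den]

def one : Prog := move (· = .bit true) .right

def endTok : Prog := move (· = .bit false) .right

def ones : ℕ → Prog
  | 0 => nop
  | t + 1 => seq (ones t) one

/-- Skip a token. -/
def skipTok : Prog := seq (star one) endTok

/-- Read a token that has to be `t`. -/
def readTok (t : ℕ) : Prog := seq (ones t) endTok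

/-- Read a token into the counter `i`. -/
def loadTok (i : ℕ) : Prog := seq (load i) endTok

/-- Subtract the next token from the counter `i`, which has to become `0`. -/
def cmp (i : ℕ) : Prog := seq (star (seq one (dec i))) (zero i)

/-- Read a token that has to be equal to the counter `i`, which becomes `0`. -/
def cmpTok (i : ℕ) : Prog := seq (cmp i) endTok

/-- Go from the end of a token back to its start. -/
def backTok : Prog :=
  seq (star (seq (move (fun _ => True) .left) (move (· = .bit true) .stay)))
    (seq (move (fun _ => True) .left) endTok)

/-- Read a token that has to be equal to the counter `i`. -/
def checkTok (i : ℕ) : Prog :=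
  seq (cmp i) (seq (move (· = .bit false) .stay) (seq backTok (loadTok i)))

variable {x : List Bool}

theorem den_one {p : ℕ} {c : ℕ → ℕ} {τ : Mem} :
    one.den x ⟨p, c⟩ τ ↔ TM.inputAt x p = .bit true ∧ τ = ⟨p + 1, c⟩ := by
  refine and_congr_right fun hb => ?_
  have : TM.moveIn x.length .right p = p + 1 := min_eq_left (by
    have h1 : p ≤ x.length := (TM.pos_of_inputAt hb).2.1
    omega)
  simp only [this]

theorem den_star_one {p : ℕ} {c : ℕ → ℕ} {τ : Mem} :
    (star one).den x ⟨p, c⟩ τ ↔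
      ∃ j, (∀ i < j, TM.inputAt x (p + i) = .bit true) ∧ τ = ⟨p + j, c⟩ := by
  constructor
  · intro h
    replace h : ReflTransGen (one.den x) ⟨p, c⟩ τ := h
    induction h with
    | refl => exact ⟨0, by simp, rfl⟩
    | tail _ h ih =>
      obtain ⟨j, hj, rfl⟩ := ih
      obtain ⟨hb, rfl⟩ := den_one.1 h
      refine ⟨j + 1, fun i hi => ?_, rfl⟩
      rcases Nat.lt_succ_iff_lt_or_eq.1 hi with hi | rfl
      · exact hj i hi
      · exact hb
  · rintro ⟨j, hj, rfl⟩
    induction j with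
    | zero => exact .refl
    | succ j ih =>
      exact ReflTransGen.tail (ih fun i hi => hj i (by omega))
        (den_one.2 ⟨hj j (by omega), rfl⟩)

theorem den_ones {t p : ℕ} {c : ℕ → ℕ} {τ : Mem} :
    (ones t).den x ⟨p, c⟩ τ ↔
      (∀ i < t, TM.inputAt x (p + i) = .bit true) ∧ τ = ⟨p + t, c⟩ := by
  induction t generalizing τ with
  | zero => simp [ones, den_nop]
  | succ t ih =>
    simp only [ones, den_seq, ih]
    constructor
    · rintro ⟨ρ, ⟨hj, rfl⟩, h⟩
      obtain ⟨hb, rfl⟩ := den_one.1 h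
      refine ⟨fun i hi => ?_, rfl⟩
      rcases Nat.lt_succ_iff_lt_or_eq.1 hi with hi | rfl
      · exact hj i hi
      · exact hb
    · rintro ⟨hj, rfl⟩
      exact ⟨_, ⟨fun i hi => hj i (by omega), rfl⟩, den_one.2 ⟨hj t (by omega), rfl⟩⟩

theorem den_star_dec {i p : ℕ} {c : ℕ → ℕ} {τ : Mem} :
    (star (seq one (dec i))).den x ⟨p, c⟩ τ ↔
      ∃ j, (∀ l < j, TM.inputAt x (p + l) = .bit true) ∧ j ≤ c i ∧
        τ = ⟨p + j, Function.update c i (c i - j)⟩ := by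
  have hbody : ∀ {p c τ}, (seq one (dec i)).den x ⟨p, c⟩ τ ↔ TM.inputAt x p = .bit true ∧
      ∃ v, c i = v + 1 ∧ τ = ⟨p + 1, Function.update c i v⟩ := by
    intro p c τ
    simp only [den_seq, den_one]
    constructor
    · rintro ⟨ρ, ⟨hb, rfl⟩, h⟩; exact ⟨hb, h⟩
    · rintro ⟨hb, h⟩; exact ⟨_, ⟨hb, rfl⟩, h⟩
  constructor
  · intro h
    replace h : ReflTransGen ((seq one (dec i)).den x) ⟨p, c⟩ τ := h
    induction h with
    | refl => exact ⟨0, by simp, by simp, by simp⟩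
    | tail _ h ih =>
      obtain ⟨j, hj, hle, rfl⟩ := ih
      obtain ⟨hb, v, hv, rfl⟩ := hbody.1 h
      simp only [Function.update_self] at hv
      refine ⟨j + 1, fun l hl => ?_, by omega, ?_⟩
      · rcases Nat.lt_succ_iff_lt_or_eq.1 hl with hl | rfl
        · exact hj l hl
        · exact hb
      · have : v = c i - (j + 1) := by omega
        simp [this, add_assoc]
  · rintro ⟨j, hj, hle, rfl⟩
    induction j with
    | zero => simp only [Nat.sub_zero, Function.update_eq_self]; exact .refl
    | succ j ih =>
      refine ReflTransGen.tail (ih (fun l hl => hj l (by omega)) (by omega))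
        (hbody.2 ⟨hj j (by omega), c i - (j + 1), ?_, ?_⟩)
      · simp only [Function.update_self]; omega
      · simp [add_assoc]

/-- The zero test forces exactly `c i` rounds. That the token ends there is left to a subsequent
check of the closing zero. -/
theorem den_cmp {i p : ℕ} {c : ℕ → ℕ} {τ : Mem} :
    (cmp i).den x ⟨p, c⟩ τ ↔
      (∀ l < c i, TM.inputAt x (p + l) = .bit true) ∧ τ = ⟨p + c i, Function.update c i 0⟩ := by
  simp only [cmp, den_seq, den_star_dec]
  constructor
  · rintro ⟨ρ, ⟨j, hj, hle, rfl⟩, h0, rfl⟩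
    simp only [Function.update_self] at h0
    obtain rfl : j = c i := by omega
    exact ⟨hj, by simp⟩
  · rintro ⟨hj, rfl⟩
    exact ⟨_, ⟨c i, hj, le_rfl, rfl⟩, by simp [den]⟩

section Token

variable {a : ℕ} {l : List ℕ} (h : encodeNats (a :: l) <:+ x)
include h

/-- The closing zero makes reading deterministic: whatever number of ones was consumed before, the
program can continue only if it was the whole token. -/
theorem den_endTok {j : ℕ} {c : ℕ → ℕ} {τ : Mem}
    (hj : ∀ i < j, TM.inputAt x (posOf x (a :: l) + i) = .bit true) :
    endTok.den x ⟨posOf x (a :: l) + j, c⟩ τ ↔ j = a ∧ τ = ⟨posOf x l, c⟩ := by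
  have hmv : TM.moveIn x.length .right (posOf x (a :: l) + a) = posOf x l := by
    rw [posOf_tail h]
    exact min_eq_left (by have := posOf_add_le h; omega)
  constructor
  · rintro ⟨hb, rfl⟩
    obtain rfl := token_unique h hj hb
    exact ⟨rfl, by simp only [hmv]⟩
  · rintro ⟨rfl, rfl⟩
    exact ⟨inputAt_token_end h, by simp only [hmv]⟩

theorem den_skipTok {c : ℕ → ℕ} {τ : Mem} :
    skipTok.den x ⟨posOf x (a :: l), c⟩ τ ↔ τ = ⟨posOf x l, c⟩ := by
  simp only [skipTok, den_seq, den_star_one]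
  constructor
  · rintro ⟨ρ, ⟨j, hj, rfl⟩, h'⟩
    exact ((den_endTok h hj).1 h').2
  · rintro rfl
    have hj := fun i (hi : i < a) => inputAt_token_lt h hi
    exact ⟨_, ⟨a, hj, rfl⟩, (den_endTok h hj).2 ⟨rfl, rfl⟩⟩

theorem den_readTok {t : ℕ} {c : ℕ → ℕ} {τ : Mem} :
    (readTok t).den x ⟨posOf x (a :: l), c⟩ τ ↔ a = t ∧ τ = ⟨posOf x l, c⟩ := by
  simp only [readTok, den_seq, den_ones]
  constructor
  · rintro ⟨ρ, ⟨hj, rfl⟩, h'⟩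
    obtain ⟨rfl, rfl⟩ := (den_endTok h hj).1 h'
    exact ⟨rfl, rfl⟩
  · rintro ⟨rfl, rfl⟩
    have hj := fun i (hi : i < a) => inputAt_token_lt h hi
    exact ⟨_, ⟨hj, rfl⟩, (den_endTok h hj).2 ⟨rfl, rfl⟩⟩

theorem den_loadTok {i : ℕ} {c : ℕ → ℕ} {τ : Mem} :
    (loadTok i).den x ⟨posOf x (a :: l), c⟩ τ ↔
      c i = 0 ∧ τ = ⟨posOf x l, Function.update c i a⟩ := by
  simp only [loadTok, den_seq]
  constructor
  · rintro ⟨ρ, ⟨h0, j, hj, rfl⟩, h'⟩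
    obtain ⟨rfl, rfl⟩ := (den_endTok h hj).1 h'
    exact ⟨h0, rfl⟩
  · rintro ⟨h0, rfl⟩
    have hj := fun i (hi : i < a) => inputAt_token_lt h hi
    exact ⟨_, ⟨h0, a, hj, rfl⟩, (den_endTok h hj).2 ⟨rfl, rfl⟩⟩

theorem den_cmpTok {i : ℕ} {c : ℕ → ℕ} {τ : Mem} :
    (cmpTok i).den x ⟨posOf x (a :: l), c⟩ τ ↔
      c i = a ∧ τ = ⟨posOf x l, Function.update c i 0⟩ := by
  simp only [cmpTok, den_seq, den_cmp]
  constructor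
  · rintro ⟨ρ, ⟨hj, rfl⟩, h'⟩
    exact (den_endTok h hj).1 h'
  · rintro ⟨rfl, rfl⟩
    have hj := fun j (hj : j < c i) => inputAt_token_lt h hj
    exact ⟨_, ⟨hj, rfl⟩, (den_endTok h hj).2 ⟨rfl, rfl⟩⟩

end Token

theorem den_star_back {p : ℕ} {c : ℕ → ℕ} {τ : Mem} :
    (star (seq (move (fun _ => True) .left) (move (· = .bit true) .stay))).den x ⟨p, c⟩ τ ↔
      ∃ j, (∀ i < j, TM.inputAt x (p - (i + 1)) = .bit true) ∧ τ = ⟨p - j, c⟩ := by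
  have hbody : ∀ {p c τ},
      (seq (move (fun _ => True) .left) (move (· = .bit true) .stay)).den x ⟨p, c⟩ τ ↔
      TM.inputAt x (p - 1) = .bit true ∧ τ = ⟨p - 1, c⟩ := by
    intro p c τ
    simp [den, TM.moveIn]
  constructor
  · intro h
    replace h : ReflTransGen (Prog.den x _) ⟨p, c⟩ τ := h
    induction h with
    | refl => exact ⟨0, by simp, rfl⟩
    | tail _ h ih =>
      obtain ⟨j, hj, rfl⟩ := ih
      obtain ⟨hb, rfl⟩ := hbody.1 h
      refine ⟨j + 1, fun i hi => ?_, by simp [Nat.sub_sub]⟩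
      rcases Nat.lt_succ_iff_lt_or_eq.1 hi with hi | rfl
      · exact hj i hi
      · rwa [Nat.sub_sub] at hb
  · rintro ⟨j, hj, rfl⟩
    induction j with
    | zero => exact .refl
    | succ j ih =>
      refine ReflTransGen.tail (ih fun i hi => hj i (by omega)) (hbody.2 ⟨?_, ?_⟩)
      · rw [Nat.sub_sub]; exact hj j (by omega)
      · rw [Nat.sub_sub]

/-- The closing zero of a preceding token `b` marks the place to stop; this is why the token must
not be the first one. -/
theorem den_backTok {a b : ℕ} {l : List ℕ} (h : encodeNats (b :: a :: l) <:+ x) {c : ℕ → ℕ}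
    {τ : Mem} :
    backTok.den x ⟨posOf x (a :: l) + a, c⟩ τ ↔ τ = ⟨posOf x (a :: l), c⟩ := by
  have h' := suffix_of_cons h
  have hprev : TM.inputAt x (posOf x (a :: l) - 1) = .bit false := by
    rw [posOf_tail h, Nat.add_sub_cancel]
    exact inputAt_token_end h
  have h1 := posOf_pos h'
  have h2 := posOf_add_le h'
  have hmv : TM.moveIn x.length .right (posOf x (a :: l) - 1) = posOf x (a :: l) := by
    simp only [TM.moveIn]
    omega
  simp only [backTok, den_seq, den_star_back]
  constructor
  · rintro ⟨ρ, ⟨j, hj, rfl⟩, ρ', ⟨-, rfl⟩, hb, rfl⟩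
    simp only [TM.moveIn, Nat.sub_sub] at hb
    have hja : j = a := by
      rcases lt_trichotomy j a with hlt | rfl | hlt
      · have := inputAt_token_lt h' (j := a - (j + 1)) (by omega)
        rw [← Nat.add_sub_assoc (by omega)] at this
        rw [this] at hb
        simp at hb
      · rfl
      · have := hj a hlt
        rw [show posOf x (a :: l) + a - (a + 1) = posOf x (a :: l) - 1 by omega, hprev] at this
        simp at this
    subst hja
    have : TM.moveIn x.length .left (posOf x (j :: l) + j - j) = posOf x (j :: l) - 1 := by
      simp [TM.moveIn]
    simp only [this, hmv]
  · rintro rfl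
    refine ⟨_, ⟨a, fun i hi => ?_, rfl⟩, _, ⟨trivial, rfl⟩, ?_, ?_⟩
    · have := inputAt_token_lt h' (j := a - (i + 1)) (by omega)
      rwa [← Nat.add_sub_assoc (by omega)] at this
    · simpa [TM.moveIn] using hprev
    · have : TM.moveIn x.length .left (posOf x (a :: l) + a - a) = posOf x (a :: l) - 1 := by
        simp [TM.moveIn]
      simp only [this, hmv]

/-- Comparison empties the counter, but the token just read equals its old value, so reading it
again restores the counter. -/
theorem den_checkTok {i a b : ℕ} {l : List ℕ} (h : encodeNats (b :: a :: l) <:+ x) {c : ℕ → ℕ}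
    {τ : Mem} :
    (checkTok i).den x ⟨posOf x (a :: l), c⟩ τ ↔ c i = a ∧ τ = ⟨posOf x l, c⟩ := by
  have h' := suffix_of_cons h
  simp only [checkTok, den_seq, den_cmp]
  constructor
  · rintro ⟨_, ⟨hj, rfl⟩, _, ⟨hb, rfl⟩, _, h1, h2⟩
    have hca := token_unique h' hj hb
    simp only [TM.moveIn, hca] at h1
    obtain rfl := (den_backTok h).1 h1
    obtain ⟨-, rfl⟩ := (den_loadTok h').1 h2
    refine ⟨hca, ?_⟩
    rw [Function.update_idem, Function.update_eq_self_iff.2 hca.symm]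
  · rintro ⟨rfl, rfl⟩
    refine ⟨_, ⟨fun j hj => inputAt_token_lt h' hj, rfl⟩, _, ⟨inputAt_token_end h', rfl⟩, _,
      (den_backTok h).2 rfl, (den_loadTok h').2 ⟨by simp, by simp⟩⟩

end Prog
end Machine

namespace Machine

open Relation (ReflTransGen)
open Factored (encodeNats)

theorem suffix_drop {x : List Bool} {L : List ℕ} (h : encodeNats L <:+ x) (j : ℕ) :
    encodeNats (L.drop j) <:+ x :=
  suffix_of_append (l := L.take j) (by rwa [List.take_append_drop])

namespace Prog

/-! ### Blocks of tokens -/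

/-- `w` repetitions of a program. -/
def times : ℕ → Prog → Prog
  | 0, _ => nop
  | w + 1, P => seq P (times w P)

/-- Skip some groups of `w` tokens, and decrease the counter `0` for each of them. -/
def skipSome (w : ℕ) : Prog := star (seq (dec 0) (times w skipTok))

/-- Skip as many groups of `w` tokens as the counter `0` says. -/
def skipAll (w : ℕ) : Prog := seq (skipSome w) (zero 0)

/-- Skip a list of groups of `w` tokens that is preceded by its length. -/
def skipBlock (w : ℕ) : Prog := seq (loadTok 0) (skipAll w)

/-- Read a list of vertices that has to contain the value of the counter `i`. -/
def vertBlock (i : ℕ) : Prog :=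
  seq (loadTok 0) (seq (skipSome 1) (seq (dec 0) (seq (checkTok i) (skipAll 1))))

/-- Read a list of edges, and apply one of them to the counter `i`. -/
def edgeBlock (i : ℕ) : Prog :=
  seq (loadTok 0) (seq (skipSome 2) (seq (dec 0) (seq (cmpTok i) (seq (loadTok i) (skipAll 2)))))

variable {x : List Bool}

theorem den_times_skipTok {w : ℕ} {L : List ℕ} (h : encodeNats L <:+ x) (hw : w ≤ L.length)
    {c : ℕ → ℕ} {τ : Mem} :
    (times w skipTok).den x ⟨posOf x L, c⟩ τ ↔ τ = ⟨posOf x (L.drop w), c⟩ := by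
  induction w generalizing L with
  | zero => simp [times, den_nop]
  | succ w ih =>
    rcases L with _ | ⟨a, L⟩
    · simp at hw
    · simp only [times, den_seq, den_skipTok h, exists_eq_left, List.drop_succ_cons]
      exact ih (suffix_of_cons h) (by simpa using hw)

/-- Counter `0` holds the number of groups that remain. The free choice of `j` is how a member of a
list is guessed. -/
theorem den_skipSome {w : ℕ} {L : List ℕ} (h : encodeNats L <:+ x) {c : ℕ → ℕ} {τ : Mem}
    (hw : w * c 0 ≤ L.length) :
    (skipSome w).den x ⟨posOf x L, c⟩ τ ↔
      ∃ j ≤ c 0, τ = ⟨posOf x (L.drop (w * j)), Function.update c 0 (c 0 - j)⟩ := by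
  have hbody : ∀ {j τ}, j < c 0 → ((seq (dec 0) (times w skipTok)).den x
      ⟨posOf x (L.drop (w * j)), Function.update c 0 (c 0 - j)⟩ τ ↔
      τ = ⟨posOf x (L.drop (w * (j + 1))), Function.update c 0 (c 0 - (j + 1))⟩) := by
    intro j τ hj
    have hl : w ≤ (L.drop (w * j)).length := by
      rw [List.length_drop]
      have : w * (j + 1) ≤ w * c 0 := Nat.mul_le_mul_left _ hj
      rw [mul_add, mul_one] at this
      omega
    simp only [den_seq]
    constructor
    · rintro ⟨ρ, ⟨v, hv, rfl⟩, h'⟩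
      rw [den_times_skipTok (suffix_drop h _) hl] at h'
      simp only [Function.update_self] at hv
      have hv : v = c 0 - (j + 1) := by omega
      rw [h', List.drop_drop, hv, Function.update_idem, mul_add, mul_one]
    · rintro rfl
      refine ⟨_, ⟨c 0 - (j + 1), by simp only [Function.update_self]; omega, rfl⟩,
        (den_times_skipTok (suffix_drop h _) hl).2 ?_⟩
      rw [List.drop_drop, Function.update_idem, mul_add, mul_one]
  constructor
  · intro h
    replace h : ReflTransGen (Prog.den x _) _ _ := h
    induction h with
    | refl => exact ⟨0, by simp, by simp⟩
    | tail _ h ih =>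
      obtain ⟨j, hj, rfl⟩ := ih
      have hj' : j < c 0 := by
        obtain ⟨ρ, ⟨v, hv, -⟩, -⟩ := h
        simp only [Function.update_self] at hv
        omega
      exact ⟨j + 1, hj', (hbody hj').1 h⟩
  · rintro ⟨j, hj, rfl⟩
    induction j with
    | zero => simp only [mul_zero, List.drop_zero, Nat.sub_zero, Function.update_eq_self]; exact .refl
    | succ j ih => exact ReflTransGen.tail (ih (by omega)) ((hbody hj).2 rfl)

theorem den_skipAll {w : ℕ} {L l : List ℕ} (h : encodeNats (L ++ l) <:+ x) {c : ℕ → ℕ} {τ : Mem}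
    (hw : L.length = w * c 0) :
    (skipAll w).den x ⟨posOf x (L ++ l), c⟩ τ ↔ τ = ⟨posOf x l, Function.update c 0 0⟩ := by
  simp only [skipAll, den_seq, den_skipSome h (c := c) (w := w) (by simp [hw])]
  constructor
  · rintro ⟨_, ⟨j, hj, rfl⟩, h0, rfl⟩
    simp only [Function.update_self] at h0
    obtain rfl : j = c 0 := by omega
    simp [← hw]
  · rintro rfl
    exact ⟨_, ⟨c 0, le_rfl, rfl⟩, by simp [den, ← hw]⟩

theorem den_skipBlock {w N : ℕ} {L l : List ℕ} (h : encodeNats (N :: (L ++ l)) <:+ x)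
    {c : ℕ → ℕ} {τ : Mem} (h0 : c 0 = 0) (hw : L.length = w * N) :
    (skipBlock w).den x ⟨posOf x (N :: (L ++ l)), c⟩ τ ↔ τ = ⟨posOf x l, c⟩ := by
  simp only [skipBlock, den_seq, den_loadTok h, h0, true_and, exists_eq_left]
  rw [den_skipAll (suffix_of_cons h) (by simpa using hw), Function.update_idem,
    Function.update_eq_self_iff.2 h0.symm]

/-- The index of the vertex is guessed. Counter `0` is scratch space, empty before and after, hence
`i ≠ 0`. -/
theorem den_vertBlock {i : ℕ} (hi : i ≠ 0) {V l : List ℕ}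
    (h : encodeNats (V.length :: (V ++ l)) <:+ x) {c : ℕ → ℕ} {τ : Mem} (h0 : c 0 = 0) :
    (vertBlock i).den x ⟨posOf x (V.length :: (V ++ l)), c⟩ τ ↔
      c i ∈ V ∧ τ = ⟨posOf x l, c⟩ := by
  have hend : ∀ {j : ℕ} (hj : j < V.length) {τ},
      (seq (checkTok i) (skipAll 1)).den x
        ⟨posOf x ((V ++ l).drop j), Function.update c 0 (V.length - (j + 1))⟩ τ ↔
      c i = V[j] ∧ τ = ⟨posOf x l, c⟩ := by
    intro j hj τ
    have hd : (V ++ l).drop j = V[j] :: (V.drop (j + 1) ++ l) := by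
      rw [List.drop_append_of_le_length hj.le, List.drop_eq_getElem_cons hj, List.cons_append]
    -- `checkTok` needs a preceding token: the previous vertex, or the length of the list if `j =
    -- 0`.
    obtain ⟨b, hb⟩ : ∃ b, (V.length :: (V ++ l)).drop j = b :: V[j] :: (V.drop (j + 1) ++ l) := by
      rw [← hd]
      exact ⟨_, List.drop_eq_getElem_cons (by simp; omega)⟩
    have hs := suffix_drop h j
    rw [hb] at hs
    have hs' := suffix_of_cons (suffix_of_cons hs)
    rw [hd]
    simp only [den_seq, den_checkTok hs]
    simp only [Function.update_of_ne hi, and_assoc, exists_and_left, exists_eq_left]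
    refine and_congr_right fun _ => ?_
    rw [den_skipAll hs' (by simp), Function.update_idem, Function.update_eq_self_iff.2 h0.symm]
  simp only [vertBlock]
  rw [den_seq]
  simp only [den_loadTok h, h0, true_and, exists_eq_left]
  rw [den_seq]
  simp only [den_skipSome (suffix_of_cons h) (c := Function.update c 0 V.length) (w := 1)
    (by simp), one_mul, Function.update_self, Function.update_idem]
  constructor
  · rintro ⟨_, ⟨j, hj, rfl⟩, _, ⟨v, hv, rfl⟩, h'⟩
    simp only [Function.update_self] at hv
    obtain rfl : v = V.length - (j + 1) := by omega
    rw [Function.update_idem] at h'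
    obtain ⟨h1, h2⟩ := (hend (by omega)).1 h'
    exact ⟨h1 ▸ List.getElem_mem _, h2⟩
  · rintro ⟨h1, h2⟩
    obtain ⟨j, hj, h1⟩ := List.getElem_of_mem h1
    refine ⟨_, ⟨j, hj.le, rfl⟩, _, ⟨V.length - (j + 1), ?_, rfl⟩, ?_⟩
    · simp only [Function.update_self]; omega
    · rw [Function.update_idem]
      exact (hend hj).2 ⟨h1.symm, h2⟩

theorem length_flatMap_pair (E : List (ℕ × ℕ)) :
    (E.flatMap fun e => [e.1, e.2]).length = 2 * E.length := by
  induction E with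
  | nil => rfl
  | cons e E ih => simp only [List.flatMap_cons, List.length_append, ih]; simp; ring

theorem drop_flatMap_pair (E : List (ℕ × ℕ)) (j : ℕ) :
    (E.flatMap fun e => [e.1, e.2]).drop (2 * j) = (E.drop j).flatMap fun e => [e.1, e.2] := by
  induction j generalizing E with
  | zero => rfl
  | succ j ih =>
    rcases E with _ | ⟨e, E⟩
    · simp
    · simp [mul_add, ih]

/-- The comparison with the tail of the guessed edge may destroy counter `i`, which is to receive
the head anyway. -/
theorem den_edgeBlock {i : ℕ} (hi : i ≠ 0) {E : List (ℕ × ℕ)} {l : List ℕ}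
    (h : encodeNats (E.length :: ((E.flatMap fun e => [e.1, e.2]) ++ l)) <:+ x) {c : ℕ → ℕ}
    {τ : Mem} (h0 : c 0 = 0) :
    (edgeBlock i).den x ⟨posOf x (E.length :: ((E.flatMap fun e => [e.1, e.2]) ++ l)), c⟩ τ ↔
      ∃ q, (c i, q) ∈ E ∧ τ = ⟨posOf x l, Function.update c i q⟩ := by
  have hend : ∀ {j : ℕ} (hj : j < E.length) {τ},
      (seq (cmpTok i) (seq (loadTok i) (skipAll 2))).den x
        ⟨posOf x (((E.flatMap fun e => [e.1, e.2]) ++ l).drop (2 * j)),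
          Function.update c 0 (E.length - (j + 1))⟩ τ ↔
      c i = E[j].1 ∧ τ = ⟨posOf x l, Function.update c i E[j].2⟩ := by
    intro j hj τ
    have hd : ((E.flatMap fun e => [e.1, e.2]) ++ l).drop (2 * j) =
        E[j].1 :: E[j].2 :: (((E.drop (j + 1)).flatMap fun e => [e.1, e.2]) ++ l) := by
      rw [List.drop_append_of_le_length (by rw [length_flatMap_pair]; omega),
        drop_flatMap_pair, List.drop_eq_getElem_cons hj]
      rfl
    have hs := suffix_drop (suffix_of_cons h) (2 * j)
    rw [hd] at hs
    have hs' := suffix_of_cons hs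
    rw [hd]
    simp only [den_seq, den_cmpTok hs]
    simp only [Function.update_of_ne hi, and_assoc, exists_and_left, exists_eq_left]
    simp only [den_loadTok hs', Function.update_self, true_and, exists_eq_left,
      Function.update_idem]
    refine and_congr_right fun _ => ?_
    rw [den_skipAll (suffix_of_cons hs') (by
      rw [length_flatMap_pair, Function.update_of_ne hi.symm]; simp)]
    rw [Function.update_comm hi.symm, Function.update_idem,
      Function.update_eq_self_iff.2 (by rw [Function.update_of_ne hi.symm, h0])]
  simp only [edgeBlock]
  rw [den_seq]
  simp only [den_loadTok h, h0, true_and, exists_eq_left]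
  rw [den_seq]
  simp only [den_skipSome (suffix_of_cons h) (c := Function.update c 0 E.length) (w := 2)
    (by simp only [Function.update_self, List.length_append, length_flatMap_pair]; omega),
    Function.update_self, Function.update_idem]
  constructor
  · rintro ⟨_, ⟨j, hj, rfl⟩, _, ⟨v, hv, rfl⟩, h'⟩
    simp only [Function.update_self] at hv
    obtain rfl : v = E.length - (j + 1) := by omega
    rw [Function.update_idem] at h'
    obtain ⟨h1, h2⟩ := (hend (by omega)).1 h'
    exact ⟨_, h1 ▸ List.getElem_mem _, h2⟩
  · rintro ⟨q, h1, h2⟩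
    obtain ⟨j, hj, h1⟩ := List.getElem_of_mem h1
    refine ⟨_, ⟨j, hj.le, rfl⟩, _, ⟨E.length - (j + 1), ?_, rfl⟩, ?_⟩
    · simp only [Function.update_self]; omega
    · rw [Function.update_idem]
      exact (hend hj).2 (by rw [h1]; exact ⟨rfl, h2⟩)

/-! ### Reading a formula -/

/-- One of the programs `P 0, …, P (n - 1)`. -/
def anyOf : ℕ → (ℕ → Prog) → Prog
  | 0, _ => fail
  | n + 1, P => alt (anyOf n P) (P n)

theorem den_anyOf {n : ℕ} {P : ℕ → Prog} {σ τ : Mem} :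
    (anyOf n P).den x σ τ ↔ ∃ l < n, (P l).den x σ τ := by
  induction n with
  | zero => simp [anyOf, den_fail]
  | succ n ih =>
    simp only [anyOf, den_alt, ih, Nat.lt_succ_iff_lt_or_eq]
    constructor
    · rintro (⟨l, hl, h⟩ | h)
      · exact ⟨l, .inl hl, h⟩
      · exact ⟨n, .inr rfl, h⟩
    · rintro ⟨l, hl | rfl, h⟩
      · exact .inl ⟨l, hl, h⟩
      · exact .inr h

/-- Skip a formula of depth less than `d`. -/
def skipF : ℕ → Prog
  | 0 => fail
  | d + 1 => alt (seq (readTok 0) (seq (skipBlock 1) (skipBlock 2)))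
      (seq (alt (readTok 1) (alt (readTok 2) (readTok 3))) (seq (skipF d) (skipF d)))

/-- Read a formula and check that the `n` counters from `i` on hold a vertex of its graph. -/
def vertF : ℕ → ℕ → ℕ → Prog
  | 0, _, _ => fail
  | d + 1, i, n =>
    alt (if n = 1 then seq (readTok 0) (seq (vertBlock i) (skipBlock 2)) else fail)
      (alt (seq (alt (readTok 1) (readTok 2))
          (anyOf (n + 1) fun l => seq (vertF d i l) (vertF d (i + l) (n - l))))
        (seq (readTok 3) (alt (seq (vertF d i n) (skipF d)) (seq (skipF d) (vertF d i n)))))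

/-- Read a formula and apply an edge of its graph to the `n` counters from `i` on. -/
def edgeF : ℕ → ℕ → ℕ → Prog
  | 0, _, _ => fail
  | d + 1, i, n =>
    alt (if n = 1 then seq (readTok 0) (seq (skipBlock 1) (edgeBlock i)) else fail)
      (alt (seq (readTok 1) (anyOf (n + 1) fun l =>
          alt (seq (vertF d i l) (edgeF d (i + l) (n - l)))
            (seq (edgeF d i l) (vertF d (i + l) (n - l)))))
        (alt (seq (readTok 2)
            (anyOf (n + 1) fun l => seq (edgeF d i l) (edgeF d (i + l) (n - l))))
          (seq (readTok 3) (alt (seq (edgeF d i n) (skipF d)) (seq (skipF d) (edgeF d i n))))))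

/-- The values of `n` counters from `i` on. -/
def seg (c : ℕ → ℕ) (i n : ℕ) : List ℕ := (List.range' i n).map c

theorem length_seg (c : ℕ → ℕ) (i n : ℕ) : (seg c i n).length = n := by simp [seg]

theorem seg_one (c : ℕ → ℕ) (i : ℕ) : seg c i 1 = [c i] := by simp [seg]

theorem seg_split (c : ℕ → ℕ) (i : ℕ) {l n : ℕ} (h : l ≤ n) :
    seg c i n = seg c i l ++ seg c (i + l) (n - l) := by
  unfold seg
  rw [← List.map_append]
  congr 1
  have := List.range'_append (s := i) (m := l) (n := n - l) (step := 1)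
  rw [one_mul, Nat.add_sub_cancel' h] at this
  exact this.symm

theorem seg_eq_iff {c c' : ℕ → ℕ} {i n : ℕ} :
    seg c i n = seg c' i n ↔ ∀ k, i ≤ k → k < i + n → c k = c' k := by
  simp only [seg, List.map_inj_left, List.mem_range'_1, and_imp]

theorem seg_eq_append {c : ℕ → ℕ} {i n : ℕ} {v u : List ℕ} (h : seg c i n = v ++ u) :
    v.length ≤ n ∧ seg c i v.length = v ∧ seg c (i + v.length) (n - v.length) = u := by
  have hl : v.length ≤ n := by
    have := congrArg List.length h
    rw [length_seg, List.length_append] at this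
    omega
  rw [seg_split c i hl] at h
  obtain ⟨h1, h2⟩ := List.append_inj h (length_seg _ _ _)
  exact ⟨hl, h1, h2⟩

-- Because of unions, one graph may have vertices of different lengths, and a flattened sequence may
-- split in several ways. Edges preserve length, so one cut serves both endpoints of an edge, and a
-- walk needs a fixed number of counters.
open Factored in
theorem _root_.Factored.Formula.adj_mem (f : Formula) {a b : List ℕ} (h : f.graph.Adj a b) :
    a ∈ f.graph.V ∧ b ∈ f.graph.V ∧ a.length = b.length := by
  induction f generalizing a b with
  | input G =>
    obtain ⟨e, he, rfl, rfl⟩ := h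
    exact ⟨⟨_, (G.edges_mem e he).1, rfl⟩, ⟨_, (G.edges_mem e he).2, rfl⟩, rfl⟩
  | cart f g hf hg =>
    obtain ⟨v₁, h1, u₁, h2, v₂, h3, u₂, h4, rfl, rfl, h⟩ := h
    refine ⟨⟨_, h1, _, h2, rfl⟩, ⟨_, h3, _, h4, rfl⟩, ?_⟩
    rcases h with ⟨rfl, h⟩ | ⟨rfl, h⟩
    · simp [(hg h).2.2]
    · simp [(hf h).2.2]
  | tensor f g hf hg =>
    obtain ⟨v₁, h1, u₁, h2, v₂, h3, u₂, h4, rfl, rfl, h, h'⟩ := h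
    refine ⟨⟨_, h1, _, h2, rfl⟩, ⟨_, h3, _, h4, rfl⟩, ?_⟩
    simp [(hf h).2.2, (hg h').2.2]
  | union f g hf hg =>
    rcases h with h | h
    · exact ⟨.inl (hf h).1, .inl (hf h).2.1, (hf h).2.2⟩
    · exact ⟨.inr (hg h).1, .inr (hg h).2.1, (hg h).2.2⟩

open Factored

/-- Programs have no stack, so the recursion over the formula is unrolled to depth `d` in the finite
control; fewer than `d` operations means that the depth suffices. This is where `k` has to be fixed.
-/
theorem den_skipF {f : Formula} {d : ℕ} {l : List ℕ} (h : encodeNats (f.tokens ++ l) <:+ x)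
    (hd : f.numOps < d) {c : ℕ → ℕ} {τ : Mem} (h0 : c 0 = 0) :
    (skipF d).den x ⟨posOf x (f.tokens ++ l), c⟩ τ ↔ τ = ⟨posOf x l, c⟩ := by
  induction f generalizing d l c τ with
  | input G =>
    obtain ⟨d, rfl⟩ : ∃ e, d = e + 1 := ⟨d - 1, by omega⟩
    simp only [Formula.tokens, InputGraph.tokens, withLength, List.cons_append,
      List.append_assoc] at h ⊢
    have h1 := suffix_of_cons h
    have h2 := suffix_of_append (suffix_of_cons h1)
    simp only [skipF, den_seq, den_alt, den_readTok h, true_and, exists_eq_left,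
      false_and, zero_ne_one, OfNat.zero_ne_ofNat, exists_false, or_false]
    simp only [den_skipBlock h1 h0 (w := 1) (one_mul _).symm, exists_eq_left]
    exact den_skipBlock h2 h0 (length_flatMap_pair _)
  | cart f g hf hg | tensor f g hf hg | union f g hf hg =>
    obtain ⟨d, rfl⟩ : ∃ e, d = e + 1 := ⟨d - 1, by omega⟩
    simp only [Formula.numOps] at hd
    simp only [Formula.tokens, List.cons_append, List.append_assoc] at h ⊢
    have h1 := suffix_of_cons h
    simp [skipF, den_seq, den_alt, den_readTok h, hf h1 (d := d) (by omega) h0,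
      hg (suffix_of_append h1) (d := d) (by omega) h0]

theorem not_den_leaf {t : ℕ} {L : List ℕ} (h : encodeNats (t :: L) <:+ x) (ht : t ≠ 0) {n : ℕ}
    {P : Prog} {c : ℕ → ℕ} {τ : Mem} :
    ¬ (if n = 1 then seq (readTok 0) P else fail).den x ⟨posOf x (t :: L), c⟩ τ := by
  split_ifs
  · simp [den_seq, den_readTok h, ht]
  · exact den_fail

/-- The counters are only inspected, so the same vertex remains available to later parts of the
pass. The place to cut and the side of a union are guessed. -/
theorem den_vertF {f : Formula} {d i n : ℕ} {l : List ℕ} (h : encodeNats (f.tokens ++ l) <:+ x)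
    (hd : f.numOps < d) (hi : 1 ≤ i) {c : ℕ → ℕ} {τ : Mem} (h0 : c 0 = 0) :
    (vertF d i n).den x ⟨posOf x (f.tokens ++ l), c⟩ τ ↔
      seg c i n ∈ f.graph.V ∧ τ = ⟨posOf x l, c⟩ := by
  -- Both products have the same vertices. The correct guess for the cut is the length of the first
  -- component.
  have hprod : ∀ {f g : Formula} {d : ℕ},
      (∀ {i n l c τ}, encodeNats (f.tokens ++ l) <:+ x → 1 ≤ i → c 0 = 0 →
        ((vertF d i n).den x ⟨posOf x (f.tokens ++ l), c⟩ τ ↔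
          seg c i n ∈ f.graph.V ∧ τ = ⟨posOf x l, c⟩)) →
      (∀ {i n l c τ}, encodeNats (g.tokens ++ l) <:+ x → 1 ≤ i → c 0 = 0 →
        ((vertF d i n).den x ⟨posOf x (g.tokens ++ l), c⟩ τ ↔
          seg c i n ∈ g.graph.V ∧ τ = ⟨posOf x l, c⟩)) →
      ∀ {i n l c τ}, encodeNats (f.tokens ++ (g.tokens ++ l)) <:+ x → 1 ≤ i → c 0 = 0 →
        ((anyOf (n + 1) fun l => seq (vertF d i l) (vertF d (i + l) (n - l))).den x
          ⟨posOf x (f.tokens ++ (g.tokens ++ l)), c⟩ τ ↔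
          (∃ v ∈ f.graph.V, ∃ u ∈ g.graph.V, seg c i n = v ++ u) ∧ τ = ⟨posOf x l, c⟩) := by
    intro f g d hf hg i n l c τ h hi h0
    simp only [den_anyOf, den_seq, hf h hi h0]
    constructor
    · rintro ⟨m, hm, _, ⟨hv, rfl⟩, h'⟩
      obtain ⟨hu, rfl⟩ := (hg (suffix_of_append h) (by omega) h0).1 h'
      exact ⟨⟨_, hv, _, hu, seg_split _ _ (by omega)⟩, rfl⟩
    · rintro ⟨⟨v, hv, u, hu, he⟩, rfl⟩
      obtain ⟨hl, h1, h2⟩ := seg_eq_append he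
      exact ⟨v.length, by omega, _, ⟨by rwa [h1], rfl⟩,
        (hg (suffix_of_append h) (by omega) h0).2 ⟨by rwa [h2], rfl⟩⟩
  induction f generalizing d i n l c τ with
  | input G =>
    obtain ⟨d, rfl⟩ : ∃ e, d = e + 1 := ⟨d - 1, by omega⟩
    simp only [Formula.tokens, InputGraph.tokens, withLength, List.cons_append,
      List.append_assoc] at h ⊢
    have h1 := suffix_of_cons h
    have h2 := suffix_of_append (suffix_of_cons h1)
    simp only [vertF, den_seq, den_alt, den_readTok h,
      false_and, zero_ne_one, OfNat.zero_ne_ofNat, exists_false, or_false]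
    have hV : seg c i n ∈ (Formula.input G).graph.V ↔ ∃ v ∈ G.verts, seg c i n = [v] := Iff.rfl
    rw [hV]
    split_ifs with hn
    · subst hn
      rw [den_seq]
      simp only [den_readTok h, true_and, exists_eq_left]
      rw [den_seq]
      simp only [den_vertBlock (by omega : i ≠ 0) h1 h0, and_assoc, exists_and_left,
        exists_eq_left]
      rw [den_skipBlock h2 h0 (length_flatMap_pair _)]
      simp [seg_one]
    · simp only [den_fail, false_iff]
      rintro ⟨⟨v, -, hv⟩, -⟩
      exact hn (by have := congrArg List.length hv; simpa [length_seg] using this)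
  | cart f g hf hg | tensor f g hf hg =>
    obtain ⟨d, rfl⟩ : ∃ e, d = e + 1 := ⟨d - 1, by omega⟩
    simp only [Formula.numOps] at hd
    simp only [Formula.tokens, List.cons_append, List.append_assoc] at h ⊢
    have h1 := suffix_of_cons h
    have := @hprod f g d (fun h hi h0 => hf h (by omega) hi h0)
      (fun h hi h0 => hg h (by omega) hi h0) i n l c τ h1 hi h0
    simp only [vertF]
    rw [den_alt, den_alt, den_seq, den_seq]
    simp only [not_den_leaf h (by decide), den_alt, den_readTok h, OfNat.ofNat_ne_one, OfNat.one_ne_ofNat,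
      Nat.reduceEqDiff, false_and, true_and, false_or,
      or_false, exists_eq_left, exists_false, this]
    rfl
  | union f g hf hg =>
    obtain ⟨d, rfl⟩ : ∃ e, d = e + 1 := ⟨d - 1, by omega⟩
    simp only [Formula.numOps] at hd
    simp only [Formula.tokens, List.cons_append, List.append_assoc] at h ⊢
    have h1 := suffix_of_cons h
    simp only [vertF]
    rw [den_alt, den_alt]
    simp only [not_den_leaf h (by decide), den_seq, den_alt, den_readTok h, OfNat.ofNat_ne_one,
      Nat.reduceEqDiff, false_and, true_and, false_or,
      or_false, exists_eq_left, exists_false, hf h1 (d := d) (by omega) hi h0,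
      den_skipF h1 (d := d) (by omega) h0, hg (suffix_of_append h1) (d := d) (by omega) hi h0,
      and_assoc, exists_and_left, den_skipF (suffix_of_append h1) (d := d) (by omega) h0]
    rw [← or_and_right]
    rfl

/-- The edge is applied in place, factor by factor. Since the other counters, in particular the
scratch counter `0`, are unchanged, the effects on disjoint segments can be combined. -/
theorem den_edgeF {f : Formula} {d i n : ℕ} {l : List ℕ} (h : encodeNats (f.tokens ++ l) <:+ x)
    (hd : f.numOps < d) (hi : 1 ≤ i) {c : ℕ → ℕ} {τ : Mem} (h0 : c 0 = 0) :
    (edgeF d i n).den x ⟨posOf x (f.tokens ++ l), c⟩ τ ↔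
      ∃ c' : ℕ → ℕ, (∀ k, k < i ∨ i + n ≤ k → c' k = c k) ∧
        f.graph.Adj (seg c i n) (seg c' i n) ∧ τ = ⟨posOf x l, c'⟩ := by
  induction f generalizing d i n l c τ with
  | input G =>
    obtain ⟨d, rfl⟩ : ∃ e, d = e + 1 := ⟨d - 1, by omega⟩
    simp only [Formula.tokens, InputGraph.tokens, withLength, List.cons_append,
      List.append_assoc] at h ⊢
    have h1 := suffix_of_cons h
    have h2 := suffix_of_append (suffix_of_cons h1)
    simp only [edgeF, den_seq, den_alt, den_readTok h,
      false_and, zero_ne_one, OfNat.zero_ne_ofNat, exists_false, or_false]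
    have hA : ∀ a b, (Formula.input G).graph.Adj a b ↔ ∃ e ∈ G.edges, a = [e.1] ∧ b = [e.2] :=
      fun _ _ => Iff.rfl
    simp only [hA]
    split_ifs with hn
    · subst hn
      rw [den_seq]
      simp only [den_readTok h, true_and, exists_eq_left]
      rw [den_seq]
      simp only [den_skipBlock h1 h0 (w := 1) (one_mul _).symm, exists_eq_left]
      rw [den_edgeBlock (by omega) h2 h0]
      simp only [seg_one, List.cons.injEq, and_true]
      constructor
      · rintro ⟨q, hq, rfl⟩
        refine ⟨_, fun k hk => Function.update_of_ne (by omega) _ _, ⟨_, hq, rfl, ?_⟩, rfl⟩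
        simp
      · rintro ⟨c', hc', ⟨e, he, h1, h2⟩, rfl⟩
        refine ⟨e.2, by rw [h1]; exact he, ?_⟩
        congr 1
        funext k
        by_cases hk : k = i
        · subst hk; simpa using h2
        · rw [Function.update_of_ne hk]
          exact hc' k (by omega)
    · simp only [den_fail, false_iff]
      rintro ⟨c', -, ⟨e, -, he, -⟩, -⟩
      exact hn (by have := congrArg List.length he; simpa [length_seg] using this)
  | cart f g hf hg =>
    obtain ⟨d, rfl⟩ : ∃ e, d = e + 1 := ⟨d - 1, by omega⟩
    simp only [Formula.numOps] at hd
    simp only [Formula.tokens, List.cons_append, List.append_assoc] at h ⊢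
    have h1 := suffix_of_cons h
    have h2 := suffix_of_append h1
    simp only [edgeF]
    rw [den_alt, den_alt, den_alt, den_seq, den_seq, den_seq]
    simp only [not_den_leaf h (by decide), den_readTok h, OfNat.one_ne_ofNat, false_and, true_and,
      false_or, or_false, exists_eq_left, exists_false, den_anyOf, den_alt]
    constructor
    · rintro ⟨m, hm, h' | h'⟩
      · obtain ⟨_, h', h''⟩ := h'
        obtain ⟨hv, rfl⟩ := (den_vertF h1 (by omega) hi h0).1 h'
        obtain ⟨c', hc', hadj, rfl⟩ := (hg h2 (by omega) (by omega) h0).1 h''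
        have hs : seg c i m = seg c' i m := seg_eq_iff.2 fun k _ hk2 => (hc' k (by omega)).symm
        obtain ⟨hu, hu', -⟩ := g.adj_mem hadj
        exact ⟨c', fun k hk => hc' k (by omega), ⟨_, hv, _, hu, _, hs ▸ hv, _, hu',
          seg_split _ _ (by omega), seg_split _ _ (by omega), .inl ⟨hs, hadj⟩⟩, rfl⟩
      · obtain ⟨_, h', h''⟩ := h'
        obtain ⟨c', hc', hadj, rfl⟩ := (hf h1 (by omega) hi h0).1 h'
        have h0' : c' 0 = 0 := by rw [hc' 0 (by omega), h0]
        obtain ⟨hv, rfl⟩ := (den_vertF h2 (by omega) (by omega) h0').1 h''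
        have hs : seg c (i + m) (n - m) = seg c' (i + m) (n - m) :=
          seg_eq_iff.2 fun k hk1 _ => (hc' k (by omega)).symm
        obtain ⟨hu, hu', -⟩ := f.adj_mem hadj
        exact ⟨c', fun k hk => hc' k (by omega), ⟨_, hu, _, hs ▸ hv, _, hu', _, hv,
          seg_split _ _ (by omega), seg_split _ _ (by omega), .inr ⟨hs, hadj⟩⟩, rfl⟩
    · rintro ⟨c', hc', ⟨v₁, hv₁, u₁, hu₁, v₂, hv₂, u₂, hu₂, he₁, he₂, hadj⟩, rfl⟩
      -- Both endpoints are cut at the same place, so the two segments of counters fit both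
      -- decompositions.
      have hlen : v₂.length = v₁.length := by
        rcases hadj with ⟨rfl, -⟩ | ⟨-, hadj⟩
        · rfl
        · exact (f.adj_mem hadj).2.2.symm
      obtain ⟨hl, e1, e2⟩ := seg_eq_append he₁
      obtain ⟨-, e3, e4⟩ := seg_eq_append he₂
      rw [hlen] at e3 e4
      refine ⟨v₁.length, by omega, ?_⟩
      rcases hadj with ⟨rfl, hadj⟩ | ⟨rfl, hadj⟩
      · refine .inl ⟨_, (den_vertF h1 (by omega) hi h0).2 ⟨by rwa [e1], rfl⟩,
          (hg h2 (by omega) (by omega) h0).2 ⟨c', fun k hk => ?_, by rwa [e2, e4], rfl⟩⟩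
        by_cases hk' : k < i ∨ i + n ≤ k
        · exact hc' k hk'
        · exact (seg_eq_iff.1 (e1.trans e3.symm) k (by omega) (by omega)).symm
      · have h0' : c' 0 = 0 := by rw [hc' 0 (by omega), h0]
        refine .inr ⟨_, (hf h1 (by omega) hi h0).2 ⟨c', fun k hk => ?_, by rwa [e1, e3], rfl⟩,
          (den_vertF h2 (by omega) (by omega) h0').2 ⟨by rwa [e4], rfl⟩⟩
        by_cases hk' : k < i ∨ i + n ≤ k
        · exact hc' k hk'
        · exact (seg_eq_iff.1 (e2.trans e4.symm) k (by omega) (by omega)).symm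
  | tensor f g hf hg =>
    obtain ⟨d, rfl⟩ : ∃ e, d = e + 1 := ⟨d - 1, by omega⟩
    simp only [Formula.numOps] at hd
    simp only [Formula.tokens, List.cons_append, List.append_assoc] at h ⊢
    have h1 := suffix_of_cons h
    have h2 := suffix_of_append h1
    simp only [edgeF]
    rw [den_alt, den_alt, den_alt, den_seq, den_seq, den_seq]
    simp only [not_den_leaf h (by decide), den_readTok h, OfNat.ofNat_ne_one, Nat.reduceEqDiff,
      false_and, true_and, false_or, or_false, exists_eq_left, exists_false, den_anyOf]
    constructor
    · rintro ⟨m, hm, _, h', h''⟩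
      obtain ⟨c₁, hc₁, hadj, rfl⟩ := (hf h1 (by omega) hi h0).1 h'
      have h0' : c₁ 0 = 0 := by rw [hc₁ 0 (by omega), h0]
      obtain ⟨c', hc', hadj', rfl⟩ := (hg h2 (by omega) (by omega) h0').1 h''
      have hs : seg c₁ i m = seg c' i m := seg_eq_iff.2 fun k _ hk2 => (hc' k (by omega)).symm
      have hs' : seg c (i + m) (n - m) = seg c₁ (i + m) (n - m) :=
        seg_eq_iff.2 fun k hk1 _ => (hc₁ k (by omega)).symm
      rw [hs] at hadj
      rw [← hs'] at hadj'
      obtain ⟨hv, hv', -⟩ := f.adj_mem hadj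
      obtain ⟨hu, hu', -⟩ := g.adj_mem hadj'
      exact ⟨c', fun k hk => (hc' k (by omega)).trans (hc₁ k (by omega)),
        ⟨_, hv, _, hu, _, hv', _, hu', seg_split _ _ (by omega), seg_split _ _ (by omega), hadj,
          hadj'⟩, rfl⟩
    · rintro ⟨c', hc', ⟨v₁, hv₁, u₁, hu₁, v₂, hv₂, u₂, hu₂, he₁, he₂, hadj, hadj'⟩, rfl⟩
      have hlen : v₂.length = v₁.length := (f.adj_mem hadj).2.2.symm
      obtain ⟨hl, e1, e2⟩ := seg_eq_append he₁
      obtain ⟨-, e3, e4⟩ := seg_eq_append he₂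
      rw [hlen] at e3 e4
      -- The memory between the two factors: the first segment is already new, the second still old.
      obtain ⟨c₁, hc₁⟩ : ∃ c₁ : ℕ → ℕ, ∀ k, c₁ k = if k < i + v₁.length then c' k else c k :=
        ⟨_, fun _ => rfl⟩
      have h0' : c₁ 0 = 0 := by rw [hc₁, if_pos (by omega), hc' 0 (by omega), h0]
      have hs : seg c₁ i v₁.length = seg c' i v₁.length :=
        seg_eq_iff.2 fun k _ hk2 => by rw [hc₁, if_pos hk2]
      have hs' : seg c₁ (i + v₁.length) (n - v₁.length) = seg c (i + v₁.length) (n - v₁.length) :=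
        seg_eq_iff.2 fun k hk1 _ => by rw [hc₁, if_neg (by omega)]
      refine ⟨v₁.length, by omega, _, (hf h1 (by omega) hi h0).2
        ⟨c₁, fun k hk => ?_, by rwa [hs, e1, e3], rfl⟩,
        (hg h2 (by omega) (by omega) h0').2 ⟨c', fun k hk => ?_, by rwa [hs', e2, e4], rfl⟩⟩
      · rw [hc₁]
        split_ifs
        · exact hc' k (by omega)
        · rfl
      · rw [hc₁]
        split_ifs
        · rfl
        · exact hc' k (by omega)
  | union f g hf hg =>
    obtain ⟨d, rfl⟩ : ∃ e, d = e + 1 := ⟨d - 1, by omega⟩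
    simp only [Formula.numOps] at hd
    simp only [Formula.tokens, List.cons_append, List.append_assoc] at h ⊢
    have h1 := suffix_of_cons h
    have h2 := suffix_of_append h1
    have hA : ∀ a b, (Formula.union f g).graph.Adj a b ↔ f.graph.Adj a b ∨ g.graph.Adj a b :=
      fun _ _ => Iff.rfl
    simp only [edgeF, hA]
    rw [den_alt, den_alt, den_alt, den_seq, den_seq, den_seq]
    simp only [not_den_leaf h (by decide), den_readTok h, OfNat.ofNat_ne_one, Nat.reduceEqDiff,
      false_and, true_and, false_or, exists_eq_left, exists_false, den_alt]
    constructor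
    · rintro (⟨_, h', h''⟩ | ⟨_, h', h''⟩)
      · obtain ⟨c', hc', hadj, rfl⟩ := (hf h1 (by omega) hi h0).1 h'
        have h0' : c' 0 = 0 := by rw [hc' 0 (by omega), h0]
        exact ⟨c', hc', .inl hadj, (den_skipF h2 (by omega) h0').1 h''⟩
      · obtain rfl := (den_skipF h1 (by omega) h0).1 h'
        obtain ⟨c', hc', hadj, rfl⟩ := (hg h2 (by omega) hi h0).1 h''
        exact ⟨c', hc', .inr hadj, rfl⟩
    · rintro ⟨c', hc', hadj | hadj, rfl⟩
      · have h0' : c' 0 = 0 := by rw [hc' 0 (by omega), h0]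
        exact .inl ⟨_, (hf h1 (by omega) hi h0).2 ⟨c', hc', hadj, rfl⟩,
          (den_skipF h2 (by omega) h0').2 rfl⟩
      · exact .inr ⟨_, (den_skipF h1 (by omega) h0).2 rfl,
          (hg h2 (by omega) hi h0).2 ⟨c', hc', hadj, rfl⟩⟩

end Prog
end Machine

namespace Machine

open Relation (ReflTransGen)
open Factored

namespace Prog

variable {x : List Bool}

/-! ### The program for reachability -/

/-- Go to the first token. -/
def rewind : Prog := seq (star (move (fun _ => True) .left)) (move (· = .leftEnd) .right)

/-- Load `m` tokens into the counters from `i` on. -/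
def loadSeq : ℕ → ℕ → Prog
  | 0, _ => nop
  | m + 1, i => seq (loadTok i) (loadSeq m (i + 1))

/-- Read `m` tokens that have to agree with the counters from `i` on. -/
def cmpSeq : ℕ → ℕ → Prog
  | 0, _ => nop
  | m + 1, i => seq (cmpTok i) (cmpSeq m (i + 1))

/-- Apply edges to the `m` counters from `1` on. -/
def walk (k m : ℕ) : Prog := star (seq rewind (edgeF k 1 m))

/-- Reachability on factored graphs given by formulas with less than `k` operations. -/
def reachability (k : ℕ) : Prog :=
  anyOf (k + 1) fun m =>
    seq rewind (seq (skipF k) (seq (readTok m) (seq (loadSeq m 1) (seq (walk k m)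
      (seq rewind (seq (skipF k) (seq skipTok (seq (times m skipTok)
        (seq (readTok m) (cmpSeq m 1))))))))))

/-- Only position `0` holds the left end-marker, so the loop can be left successfully only there. -/
theorem den_rewind {p : ℕ} {c : ℕ → ℕ} {τ : Mem} :
    rewind.den x ⟨p, c⟩ τ ↔ τ = ⟨1, c⟩ := by
  have hmv : TM.moveIn x.length .right 0 = 1 := by simp [TM.moveIn]
  constructor
  · rintro ⟨ρ, h, hb, rfl⟩
    have hc : ρ.cnt = c := by
      replace h : ReflTransGen (Prog.den x _) _ _ := h
      clear hb
      induction h with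
      | refl => rfl
      | tail _ h ih =>
        obtain ⟨-, rfl⟩ := h
        exact ih
    have hp : ρ.pos = 0 := by
      unfold TM.inputAt at hb
      split_ifs at hb with h0
      · exact h0
      · split at hb <;> simp at hb
    rw [hc, hp, hmv]
  · rintro rfl
    refine ⟨⟨0, c⟩, ?_, rfl, by simp only [hmv]⟩
    induction p with
    | zero => exact .refl
    | succ p ih => exact ReflTransGen.head ⟨trivial, rfl⟩ ih

theorem seg_succ (c : ℕ → ℕ) (i n : ℕ) : seg c i (n + 1) = c i :: seg c (i + 1) n := by
  simp [seg, List.range'_succ]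

theorem exists_seg (c : ℕ → ℕ) (i : ℕ) (w : List ℕ) :
    ∃ c' : ℕ → ℕ, (∀ k, k < i ∨ i + w.length ≤ k → c' k = c k) ∧ seg c' i w.length = w := by
  induction w generalizing i c with
  | nil => exact ⟨c, fun _ _ => rfl, rfl⟩
  | cons a w ih =>
    obtain ⟨c', h1, h2⟩ := ih (Function.update c i a) (i + 1)
    refine ⟨c', fun k hk => ?_, ?_⟩
    · simp only [List.length_cons] at hk
      rw [h1 k (by omega), Function.update_of_ne (by omega)]
    · rw [List.length_cons, seg_succ, h2, h1 i (by omega), Function.update_self]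

theorem den_loadSeq {s l : List ℕ} (h : encodeNats (s ++ l) <:+ x) {i : ℕ} {c : ℕ → ℕ} {τ : Mem}
    (h0 : ∀ k, i ≤ k → c k = 0) :
    (loadSeq s.length i).den x ⟨posOf x (s ++ l), c⟩ τ ↔
      ∃ c' : ℕ → ℕ, (∀ k, k < i ∨ i + s.length ≤ k → c' k = c k) ∧ seg c' i s.length = s ∧
        τ = ⟨posOf x l, c'⟩ := by
  induction s generalizing i c with
  | nil =>
    simp only [List.length_nil, loadSeq, den_nop, List.nil_append]
    constructor
    · rintro rfl; exact ⟨c, fun _ _ => rfl, rfl, rfl⟩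
    · rintro ⟨c', h1, -, rfl⟩
      rw [show c' = c from funext fun k => h1 k (by omega)]
  | cons a s ih =>
    rw [List.cons_append] at h ⊢
    simp only [List.length_cons, loadSeq, den_seq, den_loadTok h, h0 i le_rfl, true_and,
      exists_eq_left]
    rw [ih (suffix_of_cons h) (fun k hk => by
      rw [Function.update_of_ne (by omega)]; exact h0 k (by omega))]
    constructor
    · rintro ⟨c', h1, h2, rfl⟩
      refine ⟨c', fun k hk => ?_, ?_, rfl⟩
      · rw [h1 k (by omega), Function.update_of_ne (by omega)]
      · rw [seg_succ, h2, h1 i (by omega), Function.update_self]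
    · rintro ⟨c', h1, h2, rfl⟩
      rw [seg_succ, List.cons.injEq] at h2
      refine ⟨c', fun k hk => ?_, h2.2, rfl⟩
      by_cases hki : k = i
      · subst hki; rw [Function.update_self, h2.1]
      · rw [Function.update_of_ne hki]
        exact h1 k (by omega)

/-- This is the end of the algorithm, so the counters may be destroyed and only executability
matters. -/
theorem den_cmpSeq {t l : List ℕ} (h : encodeNats (t ++ l) <:+ x) {i : ℕ} {c : ℕ → ℕ} :
    (∃ τ, (cmpSeq t.length i).den x ⟨posOf x (t ++ l), c⟩ τ) ↔ seg c i t.length = t := by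
  induction t generalizing i c with
  | nil => simp [cmpSeq, den_nop, seg]
  | cons a t ih =>
    rw [List.cons_append] at h ⊢
    simp only [List.length_cons, cmpSeq, den_seq, den_cmpTok h, seg_succ, List.cons.injEq, and_assoc,
      exists_and_left, exists_eq_left]
    rw [ih (suffix_of_cons h)]
    have : seg (Function.update c i 0) (i + 1) t.length = seg c (i + 1) t.length :=
      seg_eq_iff.2 fun k hk _ => Function.update_of_ne (by omega) _ _
    rw [this]

theorem posOf_encodeNats (l : List ℕ) : posOf (encodeNats l) l = 1 := by
  unfold posOf; omega

section Walk

variable {f : Formula} {k m : ℕ} {l : List ℕ} (hx : x = encodeNats (f.tokens ++ l))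
  (hk : f.numOps < k)
include hx hk

theorem den_walk_step {p : ℕ} {c : ℕ → ℕ} (h0 : c 0 = 0) {τ : Mem} :
    (seq rewind (edgeF k 1 m)).den x ⟨p, c⟩ τ ↔
      ∃ c' : ℕ → ℕ, (∀ k, k < 1 ∨ 1 + m ≤ k → c' k = c k) ∧
        f.graph.Adj (seg c 1 m) (seg c' 1 m) ∧ τ = ⟨posOf x l, c'⟩ := by
  rw [den_seq]
  simp only [den_rewind, exists_eq_left]
  have hp : posOf x (f.tokens ++ l) = 1 := by rw [hx]; exact posOf_encodeNats _
  have := den_edgeF (x := x) (l := l) (n := m) (τ := τ) (by rw [hx]) hk le_rfl h0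
  rwa [hp] at this

/-- Each round is one edge; the emptiness of counter `0` is carried along because the next round
presupposes it. -/
theorem reaches_of_walk {p : ℕ} {c : ℕ → ℕ} (h0 : c 0 = 0) {τ : Mem}
    (h : (walk k m).den x ⟨p, c⟩ τ) :
    τ.cnt 0 = 0 ∧ f.graph.Reaches (seg c 1 m) (seg τ.cnt 1 m) := by
  replace h : ReflTransGen (Prog.den x (seq rewind (edgeF k 1 m))) ⟨p, c⟩ τ := h
  induction h with
  | refl => exact ⟨h0, .refl⟩
  | tail _ h ih =>
    obtain ⟨c', h1, h2, rfl⟩ := (den_walk_step hx hk ih.1).1 h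
    exact ⟨(h1 0 (by omega)).trans ih.1, ih.2.tail h2⟩

theorem walk_of_reaches {p : ℕ} {c : ℕ → ℕ} (h0 : c 0 = 0) {w : List ℕ}
    (h : f.graph.Reaches (seg c 1 m) w) :
    ∃ τ, (walk k m).den x ⟨p, c⟩ τ ∧ τ.cnt 0 = 0 ∧ seg τ.cnt 1 m = w := by
  induction h with
  | refl => exact ⟨_, .refl, h0, rfl⟩
  | @tail u v _ h ih =>
    obtain ⟨τ, h1, h2, rfl⟩ := ih
    have hv : v.length = m := by rw [← (f.adj_mem h).2.2, length_seg]
    subst hv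
    obtain ⟨c', h3, h4⟩ := exists_seg τ.cnt 1 v
    refine ⟨_, ReflTransGen.tail h1 ((den_walk_step hx hk h2).2 ⟨c', h3, by rwa [h4], rfl⟩),
      (h3 0 (by omega)).trans h2, h4⟩

end Walk

/-- There are `numOps + 1` input graphs, and each contributes at most one label. Hence `k` counters
suffice, and guessing a length `m ≤ k` covers all sources. -/
theorem _root_.Factored.Formula.length_of_mem (f : Formula) {w : List ℕ} (h : w ∈ f.graph.V) :
    w.length ≤ f.numOps + 1 := by
  induction f generalizing w with
  | input G =>
    obtain ⟨v, -, rfl⟩ := h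
    simp
  | cart f g hf hg | tensor f g hf hg =>
    obtain ⟨v, hv, u, hu, rfl⟩ := h
    have := hf hv
    have := hg hu
    simp only [List.length_append, Formula.numOps]
    omega
  | union f g hf hg =>
    simp only [Formula.numOps]
    rcases h with h | h
    · have := hf h; omega
    · have := hg h; omega

theorem exists_den_reachability {k : ℕ} (I : Instance) (hk : I.formula.numOps + 1 = k) :
    (∃ τ, (reachability k).den I.encode Mem.init τ) ↔ I.Yes := by
  obtain ⟨f, s, t, hs, ht⟩ := I
  simp only at hk
  have hkf : f.numOps < k := by omega
  generalize hx : Instance.encode ⟨f, s, t, hs, ht⟩ = x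
  replace hx : x = encodeNats (f.tokens ++ (s.length :: (s ++ (t.length :: (t ++ []))))) := by
    rw [← hx]
    simp [Instance.encode, withLength]
  have h1 : encodeNats (f.tokens ++ (s.length :: (s ++ (t.length :: (t ++ []))))) <:+ x := by
    rw [hx]
  have h2 := suffix_of_append h1
  have h3 := suffix_of_cons h2
  have h4 := suffix_of_append h3
  have h5 := suffix_of_cons h4
  have hp : posOf x (f.tokens ++ (s.length :: (s ++ (t.length :: (t ++ []))))) = 1 := by
    rw [hx]; exact posOf_encodeNats _
  have hskip : ∀ {c : ℕ → ℕ} {τ : Mem}, c 0 = 0 → ((skipF k).den x ⟨1, c⟩ τ ↔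
      τ = ⟨posOf x (s.length :: (s ++ (t.length :: (t ++ [])))), c⟩) := by
    intro c τ h0
    rw [← hp]
    exact den_skipF h1 hkf h0
  -- The target is required to have the length of the source, without loss because edges preserve
  -- length.
  have htail : ∀ {σ : Mem}, σ.cnt 0 = 0 →
      ((∃ τ, (seq rewind (seq (skipF k) (seq skipTok (seq (times s.length skipTok)
        (seq (readTok s.length) (cmpSeq s.length 1)))))).den x σ τ) ↔
      seg σ.cnt 1 s.length = t) := by
    rintro ⟨p, c⟩ h0
    have hd : (s ++ (t.length :: (t ++ []))).drop s.length = t.length :: (t ++ []) := by simp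
    simp only [den_seq, den_rewind, exists_eq_left, hskip h0, den_skipTok h2,
      den_times_skipTok h3 (w := s.length) (by simp), hd, den_readTok h4, and_assoc,
      exists_and_left]
    constructor
    · rintro ⟨hl, τ, h⟩
      rw [← hl] at h ⊢
      exact (den_cmpSeq h5).1 ⟨τ, h⟩
    · intro h
      have hl : t.length = s.length := by rw [← h, length_seg]
      rw [← hl] at h ⊢
      obtain ⟨τ, hτ⟩ := (den_cmpSeq h5).2 h
      exact ⟨rfl, τ, hτ⟩
  have hhead : ∀ {m : ℕ} {τ : Mem} {P : Prog},
      (seq rewind (seq (skipF k) (seq (readTok m) (seq (loadSeq m 1) P)))).den x Mem.init τ ↔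
      s.length = m ∧ ∃ c : ℕ → ℕ, (∀ k, k < 1 ∨ 1 + s.length ≤ k → c k = 0) ∧
        seg c 1 s.length = s ∧ P.den x ⟨posOf x (t.length :: (t ++ [])), c⟩ τ := by
    intro m τ P
    simp only [den_seq, Mem.init, den_rewind, exists_eq_left, hskip, den_readTok h2, and_assoc,
      exists_and_left]
    refine and_congr_right fun hm => ?_
    subst hm
    simp only [den_loadSeq h3 (i := 1) (c := fun _ => 0) (fun _ _ => rfl)]
    constructor
    · rintro ⟨_, ⟨c, h1, h2, rfl⟩, h⟩; exact ⟨c, h1, h2, h⟩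
    · rintro ⟨c, h1, h2, h⟩; exact ⟨_, ⟨c, h1, h2, rfl⟩, h⟩
  unfold reachability
  simp only [den_anyOf, hhead]
  show _ ↔ f.graph.Reaches s t
  constructor
  · rintro ⟨τ, m, -, rfl, c, hc0, hc, σ, hw, h⟩
    obtain ⟨hσ, hr⟩ := reaches_of_walk hx hkf (hc0 0 (by omega)) hw
    have := (htail hσ).1 ⟨τ, h⟩
    rwa [hc, this] at hr
  · intro hr
    obtain ⟨c, hc0, hc⟩ := exists_seg (fun _ => 0) 1 s
    obtain ⟨σ, hw, hσ, he⟩ := walk_of_reaches (m := s.length) hx hkf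
      (p := posOf x (t.length :: (t ++ []))) (hc0 0 (by omega)) (w := t) (by rwa [hc])
    obtain ⟨τ, hτ⟩ := (htail hσ).2 he
    exact ⟨τ, s.length, by have := f.length_of_mem hs; omega, rfl, c, hc0, hc, σ, hw, hτ⟩

end Prog
end Machine

namespace Factored

open Machine (encodeNats_cons encodeNats_append)

/-! ### The length of instances -/

/-- A token `a` occupies `a + 1 ≤ N` bits. -/
theorem length_encodeNats_le {l : List ℕ} {N : ℕ} (h : ∀ a ∈ l, a < N) :
    (encodeNats l).length ≤ l.length * N := by
  induction l with
  | nil => simp [encodeNats]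
  | cons a l ih =>
    have h1 := ih fun b hb => h b (List.mem_cons_of_mem _ hb)
    have h2 := h a List.mem_cons_self
    rw [encodeNats_cons, List.length_append, List.length_replicate, List.length_cons,
      List.length_cons, add_mul]
    omega

theorem InputGraph.length_edges_le (G : InputGraph) :
    G.edges.length ≤ G.verts.length * G.verts.length := by
  rw [← List.toFinset_card_of_nodup G.edges_nodup, ← List.toFinset_card_of_nodup G.verts_nodup,
    ← Finset.card_product]
  refine Finset.card_le_card fun e he => ?_
  rw [List.mem_toFinset] at he
  simpa using G.edges_mem e he

theorem InputGraph.length_encodeNats_tokens_le (G : InputGraph) {n N : ℕ}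
    (hn : G.verts.length ≤ n) (hN : ∀ v ∈ G.verts, v < N) :
    (encodeNats G.tokens).length ≤ n + 1 + n * N + (n * n + 1 + 2 * (n * n) * N) := by
  have h1 := length_encodeNats_le hN
  have h2 : (encodeNats (G.edges.flatMap fun e => [e.1, e.2])).length ≤ 2 * G.edges.length * N := by
    rw [← Machine.Prog.length_flatMap_pair]
    refine length_encodeNats_le fun a ha => ?_
    obtain ⟨e, he, ha⟩ := List.mem_flatMap.1 ha
    have := G.edges_mem e he
    simp only [List.mem_cons, List.not_mem_nil, or_false] at ha
    rcases ha with rfl | rfl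
    · exact hN _ this.1
    · exact hN _ this.2
  have h3 : G.edges.length ≤ n * n := G.length_edges_le.trans (Nat.mul_le_mul hn hn)
  have h4 : G.verts.length * N ≤ n * N := Nat.mul_le_mul_right _ hn
  have h5 : 2 * G.edges.length * N ≤ 2 * (n * n) * N :=
    Nat.mul_le_mul_right _ (Nat.mul_le_mul_left _ h3)
  rw [InputGraph.tokens, encodeNats_append, withLength, encodeNats_cons, encodeNats_cons]
  simp only [List.length_append, List.length_replicate, List.length_cons]
  omega

namespace Formula

/-- An instance has a source, which rules out `n = 0`, where a bound `g k * n ^ C` could leave no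
time at all. -/
theorem one_le_of_mem (f : Formula) {n : ℕ} (hn : ∀ G ∈ f.inputs, G.verts.length ≤ n)
    {w : List ℕ} (h : w ∈ f.graph.V) : 1 ≤ n := by
  induction f generalizing w with
  | input G =>
    obtain ⟨v, hv, -⟩ := h
    have := List.length_pos_of_mem hv
    have := hn G (List.mem_singleton_self G)
    omega
  | cart f g hf hg | tensor f g hf hg =>
    obtain ⟨v, hv, -⟩ := h
    exact hf (fun G hG => hn G (List.mem_append_left _ hG)) hv
  | union f g hf hg =>
    rcases h with h | h
    · exact hf (fun G hG => hn G (List.mem_append_left _ hG)) h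
    · exact hg (fun G hG => hn G (List.mem_append_right _ hG)) h

theorem LabelsBelow.lt_of_mem {f : Formula} {N : ℕ} (hN : f.LabelsBelow N) {w : List ℕ}
    (h : w ∈ f.graph.V) : ∀ a ∈ w, a < N := by
  induction f generalizing w with
  | input G =>
    obtain ⟨v, hv, rfl⟩ := h
    simpa using hN G (List.mem_singleton_self G) v hv
  | cart f g hf hg | tensor f g hf hg =>
    obtain ⟨v, hv, u, hu, rfl⟩ := h
    intro a ha
    rcases List.mem_append.1 ha with ha | ha
    · exact hf (fun G hG => hN G (List.mem_append_left _ hG)) hv a ha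
    · exact hg (fun G hG => hN G (List.mem_append_right _ hG)) hu a ha
  | union f g hf hg =>
    rcases h with h | h
    · exact hf (fun G hG => hN G (List.mem_append_left _ hG)) h
    · exact hg (fun G hG => hN G (List.mem_append_right _ hG)) h

/-- The syntax tree has `2 * numOps + 1` nodes, and each costs at most `K`: an operation at most `4`
bits for its tag, an input graph its own code and the one-bit tag. -/
theorem length_encodeNats_tokens_le (f : Formula) {K : ℕ} (hK : 4 ≤ K)
    (h : ∀ G ∈ f.inputs, (encodeNats G.tokens).length + 1 ≤ K) :
    (encodeNats f.tokens).length ≤ (2 * f.numOps + 1) * K := by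
  induction f with
  | input G =>
    have := h G (List.mem_singleton_self G)
    simp only [tokens, numOps, encodeNats_cons, List.length_append, List.length_replicate,
      List.length_cons]
    omega
  | cart f g hf hg | tensor f g hf hg | union f g hf hg =>
    have h1 := hf fun G hG => h G (List.mem_append_left _ hG)
    have h2 := hg fun G hG => h G (List.mem_append_right _ hG)
    simp only [tokens, numOps, encodeNats_cons, encodeNats_append, List.length_append,
      List.length_replicate, List.length_cons]
    calc _ ≤ K + ((2 * f.numOps + 1) * K + (2 * g.numOps + 1) * K) := by omega
      _ = _ := by ring

end Formula

/-- An input graph costs at most `8 k n³` bits, mainly for up to `n²` edges with labels below `k n`.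
Fewer than `2 k` nodes give `16 k² n³`, and source and target add `3 k² n³` each. -/
theorem Instance.length_encode_le (I : Instance) {n k : ℕ} (h : I.HasComplexity n k) :
    1 ≤ n ∧ I.encode.length ≤ 22 * k ^ 2 * n ^ 3 := by
  obtain ⟨f, s, t, hs, ht⟩ := I
  obtain ⟨⟨hk, hn⟩, hN⟩ := h
  simp only at hk hn hN
  have h1 : 1 ≤ n := f.one_le_of_mem hn hs
  refine ⟨h1, ?_⟩
  have hk1 : 1 ≤ k := by omega
  have hn2 : n ≤ n ^ 3 := Nat.le_self_pow (by norm_num) n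
  have hn3 : n ^ 2 ≤ n ^ 3 := Nat.pow_le_pow_right h1 (by norm_num)
  have hn1 : 1 ≤ n ^ 3 := Nat.one_le_pow _ _ h1
  have hkn : ∀ {a : ℕ}, a ≤ n ^ 3 → a ≤ k * n ^ 3 := fun h =>
    h.trans (Nat.le_mul_of_pos_left _ hk1)
  have hin : ∀ G ∈ f.inputs, (encodeNats G.tokens).length + 1 ≤ 8 * (k * n ^ 3) := by
    intro G hG
    have h2 := G.length_encodeNats_tokens_le (hn G hG) (hN G hG)
    have h3 : n * (k * n) = k * n ^ 2 := by ring
    have h4 : 2 * (n * n) * (k * n) = 2 * (k * n ^ 3) := by ring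
    have h5 : k * n ^ 2 ≤ k * n ^ 3 := Nat.mul_le_mul_left _ hn3
    have h6 : n * n = n ^ 2 := by ring
    have := hkn hn1
    have := hkn hn2
    have := hkn hn3
    rw [h3, h4, h6] at h2
    omega
  have hf := f.length_encodeNats_tokens_le (by have := hkn hn1; omega) hin
  have hw : ∀ {w}, w ∈ f.graph.V → (encodeNats (withLength w)).length ≤ 3 * (k ^ 2 * n ^ 3) := by
    intro w hw
    have h2 := length_encodeNats_le (hN.lt_of_mem hw)
    have h3 : w.length ≤ k := hk ▸ f.length_of_mem hw
    have h4 : w.length * (k * n) ≤ k * (k * n) := Nat.mul_le_mul_right _ h3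
    have h5 : k * (k * n) = k ^ 2 * n := by ring
    have h6 : k ^ 2 * n ≤ k ^ 2 * n ^ 3 := Nat.mul_le_mul_left _ hn2
    have h7 : k ≤ k ^ 2 := Nat.le_self_pow (by norm_num) k
    have h8 : k ^ 2 ≤ k ^ 2 * n ^ 3 := Nat.le_mul_of_pos_right _ hn1
    rw [withLength, encodeNats_cons, List.length_append, List.length_replicate, List.length_cons]
    omega
  have h2 := hw hs
  have h3 := hw ht
  have h4 : (2 * f.numOps + 1) * (8 * (k * n ^ 3)) ≤ 2 * k * (8 * (k * n ^ 3)) :=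
    Nat.mul_le_mul_right _ (by omega)
  have h5 : 2 * k * (8 * (k * n ^ 3)) = 16 * (k ^ 2 * n ^ 3) := by ring
  have h6 : 22 * k ^ 2 * n ^ 3 = 22 * (k ^ 2 * n ^ 3) := by ring
  simp only [Instance.encode, encodeNats_append, List.length_append]
  omega

theorem Instance.one_le_length_encode (I : Instance) : 1 ≤ I.encode.length := by
  simp only [Instance.encode, encodeNats_append, withLength, encodeNats_cons, List.length_append,
    List.length_cons]
  omega

end Factored

theorem theorem4 (h : ¬ Factored.ReachabilityFPT) :
    ¬ ∃ C : ℝ, Machine.NL ⊆ Machine.DTIME (fun n => (n : ℝ) ^ C) := by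
  rintro ⟨C, hC⟩
  refine h ?_
  have hM := fun k => hC (Machine.Prog.mem_NL (Machine.Prog.reachability k))
  choose M hdet c hc using hM
  -- The factor `3` comes from the length bound `22 k² n³`. The machine and its constant depend on
  -- `k`, the exponent does not.
  refine ⟨3 * ⌈C⌉₊, fun k => c k * (22 * k ^ 2) ^ ⌈C⌉₊ + c k, fun k => ⟨M k, hdet k, ?_⟩⟩
  intro I n hI
  obtain ⟨t, ht, hans⟩ := hc k I.encode
  obtain ⟨h1, hlen⟩ := I.length_encode_le hI
  refine ⟨t, ?_, ?_⟩
  -- Rounding the exponent up increases the power because the base is at least `1`; this also covers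
  -- negative `C`.
  · have hpow : (I.encode.length : ℝ) ^ C ≤ ((I.encode.length ^ ⌈C⌉₊ : ℕ) : ℝ) := by
      rw [Nat.cast_pow, ← Real.rpow_natCast]
      exact Real.rpow_le_rpow_of_exponent_le (by exact_mod_cast I.one_le_length_encode)
        (Nat.le_ceil C)
    have ht' : t ≤ c k * I.encode.length ^ ⌈C⌉₊ + c k := by
      have : (t : ℝ) ≤ c k * ((I.encode.length ^ ⌈C⌉₊ : ℕ) : ℝ) + c k :=
        ht.trans (by gcongr)
      exact_mod_cast this
    calc t ≤ c k * I.encode.length ^ ⌈C⌉₊ + c k := ht'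
      _ ≤ c k * (22 * k ^ 2 * n ^ 3) ^ ⌈C⌉₊ + c k * n ^ (3 * ⌈C⌉₊) :=
        add_le_add (by gcongr) (Nat.le_mul_of_pos_right _ (Nat.pow_pos h1))
      _ = (c k * (22 * k ^ 2) ^ ⌈C⌉₊ + c k) * n ^ (3 * ⌈C⌉₊) := by ring
  · have hiff := Machine.Prog.exists_den_reachability I hI.1.1
    rw [← propext hiff]
    exact hans
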